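/- Let $p$ be a prime and $n\ge 0$ an integer with $p>n+1$. Let $K$ be a finite extension of $\mathbb{Q}_p$ with ramification index $e=e(K/\mathbb{Q}_p)$, and let $v_p$ be the valuation of $K$ with $v_p(p)=1$. Let $B$ (resp. $G$) be the group of matrices in $GL_n(\mathbb{Z}_p)$ that are lower triangular (resp. lower unipotent) modulo $p$; $G$ is the pro-$p$ Iwahori subgroup. Let $T_0\subset P_0$ be the diagonal and the upper triangular matrices in $B$, and let $U\subset B$ be the group of lower unipotent matrices, identified with $\mathbb{Z}_p^{d}$, $d=n(n-1)/2$, by its entries $a_{i,j}$, $i>j$. For a finite set $I$ and a $K$-Banach space $V$, a map $\mathbb{Z}_p^I\to V$ is called globally analytic if it has the form $x\mapsto\sum_{k\in\mathbb{N}^I}x^kv_k$ with $v_k\in V$, $v_k\to 0$; $\mathcal{A}(\mathbb{Z}_p^I,K)$ denotes the Tate algebra of such maps with $V=K$, normed by $\sup_k|v_k|$. The group $G$ is identified with $\mathbb{Z}_p^{n^2}$ as the ordered product of the families $1+yE_{i,j}$ ($i>j$, in lexicographic order), then $1+pyE_{i,i}$ ($i=1,\dots,n$), then $1+pyE_{i,j}$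 ($i<j$, in reversed lexicographic order), $y\in\mathbb{Z}_p$; this defines globally analytic maps on $G$ and $\mathcal{A}(G,K)$. Let $\chi=(\chi_1,\dots,\chi_n):T_0\to K^\times$, $\chi(t_1,\dots,t_n)=\chi_1(t_1)\cdots\chi_n(t_n)$, be a locally analytic character, extended to $P_0$ through the diagonal, and let $c_i=\frac{d}{dt}\chi_i(t)|_{t=1}\in K$. Assume that $\chi$ is analytic, that is, $v_p(c_i)>\frac{e}{p-1}-1$ for all $i$ and, in case $K$ contains a primitive $p$-th root of unity, moreover that each function $u\mapsto\chi_i(1+pu)$ is globally analytic on $\mathbb{Z}_p$. Let $\mathrm{ind}_{P_0}^B(\chi)_{\mathrm{loc}}$ be the space of locally analytic functions $f:B\to K$ with $f(gb)=\chi(b^{-1})f(g)$ for $g\in B$, $b\in P_0$, and let $\mathrm{ind}_{P_0}^B(\chi)$ be its subspace of globally analytic vectors, i.e. of those $f$ whose restriction to $U$ is globally analytic. Then restriction to $U$ is an isomorphism of $\mathrm{ind}_{P_0}^B(\chi)$ onto $\mathcal{A}(\mathbb{Z}_p^{n(n-1)/2},K)$. The subspace $\mathrm{ind}_{P_0}^B(\chi)$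 is stable under left translation $(h\cdot f)(g)=f(h^{-1}g)$ by $h\in G$, which gives a representation $\pi$ of $G$ by continuous linear operators on the Banach space $V=\mathcal{A}(\mathbb{Z}_p^{n(n-1)/2},K)$. This representation is globally analytic: for each $v\in V$ the map $G\to V$, $g\mapsto\pi(g)v$, is globally analytic. It is also admissible in the sense of Emerton: the continuous dual $V'$ is a finitely generated module over the convolution algebra $D(G,K)=\mathcal{A}(G,K)'$ (continuous dual), acting by $(\mu\star\ell)(v)=\mu\bigl(g\mapsto\ell(\pi(g^{-1})v)\bigr)$. -/

import Mathlib

open scoped ZeroAtInfty Matrix Topology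
open Filter

namespace IwahoriSeries

/-! ### Triangular subgroups of `GL_n` -/

section Triangular

variable {R : Type*} [CommRing R] {n : ℕ}

/-- Invertible matrices that are block triangular for a labelling `b` of the
indices: `b = id` gives the upper triangular, `b = OrderDual.toDual` the lower triangular ones. -/
def triangularGL {α : Type*} [LinearOrder α] (R : Type*) [CommRing R] {n : ℕ} (b : Fin n → α) :
    Subgroup (GL (Fin n) R) where
  carrier := {g | (g : Matrix (Fin n) (Fin n) R).BlockTriangular b}
  mul_mem' := by
    intro g h hg hh
    have : (g.1 * h.1).BlockTriangular b := Matrix.BlockTriangular.mul hg hh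
    simpa using this
  one_mem' := by
    simpa using (Matrix.blockTriangular_one (b := b))
  inv_mem' := by
    intro g hg
    have : Invertible g.1 := g.invertible
    have : (g.1⁻¹).BlockTriangular b := Matrix.blockTriangular_inv_of_blockTriangular hg
    simpa using this

/-- Upper triangular invertible matrices: the entries `(i, j)` with `j < i` vanish. -/
def upperGL (R : Type*) [CommRing R] (n : ℕ) : Subgroup (GL (Fin n) R) :=
  triangularGL R (fun i : Fin n => i)

/-- Lower triangular invertible matrices: the entries `(i, j)` with `i < j` vanish. -/
def lowerGL (R : Type*) [CommRing R] (n : ℕ) : Subgroup (GL (Fin n) R) :=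
  triangularGL R (fun i : Fin n => OrderDual.toDual i)

lemma mem_upperGL {g : GL (Fin n) R} : g ∈ upperGL R n ↔ ∀ i j, j < i → g i j = 0 := Iff.rfl

lemma mem_lowerGL {g : GL (Fin n) R} : g ∈ lowerGL R n ↔ ∀ i j, i < j → g i j = 0 := Iff.rfl

lemma lowerGL_mul_diag {g h : GL (Fin n) R} (hg : g ∈ lowerGL R n) (hh : h ∈ lowerGL R n)
    (i : Fin n) : (g * h) i i = g i i * h i i := by
  rw [mem_lowerGL] at hg hh
  change (g.1 * h.1) i i = _
  rw [Matrix.mul_apply]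
  refine Finset.sum_eq_single i (fun j _ hj => ?_) (by simp)
  rcases lt_or_gt_of_ne hj with h1 | h1
  · have := hh j i h1
    simp only [this, mul_zero]
  · have := hg i j h1
    simp only [this, zero_mul]

/-- Lower unipotent matrices: lower triangular with `1` on the diagonal. -/
def lowerUnipotentGL (R : Type*) [CommRing R] (n : ℕ) : Subgroup (GL (Fin n) R) where
  carrier := {g | g ∈ lowerGL R n ∧ ∀ i, g i i = 1}
  mul_mem' := by
    rintro g h ⟨hg, hg1⟩ ⟨hh, hh1⟩
    exact ⟨mul_mem hg hh, fun i => by rw [lowerGL_mul_diag hg hh, hg1, hh1, mul_one]⟩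
  one_mem' := ⟨one_mem _, fun i => by simp⟩
  inv_mem' := by
    rintro g ⟨hg, hg1⟩
    refine ⟨inv_mem hg, fun i => ?_⟩
    have h := lowerGL_mul_diag (inv_mem hg) hg i
    rw [hg1, mul_one, inv_mul_cancel] at h
    rw [← h]
    simp

lemma isUnit_diag {g : GL (Fin n) R} (hg : g ∈ upperGL R n) (i : Fin n) : IsUnit (g i i) := by
  have h1 : g.1.det = ∏ j, g j j := Matrix.det_of_isUpperTriangular hg
  have h2 : IsUnit g.1.det := (Matrix.isUnit_iff_isUnit_det _).1 g.isUnit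
  rw [h1] at h2
  exact isUnit_of_dvd_unit (Finset.dvd_prod_of_mem (fun j => g j j) (Finset.mem_univ i)) h2

end Triangular

/-! ### The Iwahori subgroup and its pro-`p` Iwahori subgroup -/

section Groups

variable (p : ℕ) [Fact p.Prime] (n : ℕ)

/-- Reduction modulo `p`. -/
noncomputable abbrev reduction : GL (Fin n) ℤ_[p] →* GL (Fin n) (ZMod p) :=
  Matrix.GeneralLinearGroup.map PadicInt.toZMod

/-- The Iwahori subgroup `B`: matrices in `GL_n(ℤ_p)` that are lower triangular modulo `p`. -/
noncomputable def iwahori : Subgroup (GL (Fin n) ℤ_[p]) :=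
  (lowerGL (ZMod p) n).comap (reduction p n)

/-- The pro-`p` Iwahori subgroup `G`: matrices in `GL_n(ℤ_p)` that are lower unipotent
modulo `p`. -/
noncomputable def proPIwahori : Subgroup (GL (Fin n) ℤ_[p]) :=
  (lowerUnipotentGL (ZMod p) n).comap (reduction p n)

/-- The lower unipotent subgroup `U` of `GL_n(ℤ_p)`. -/
noncomputable def lowerU : Subgroup (GL (Fin n) ℤ_[p]) := lowerUnipotentGL ℤ_[p] n

/-- The subgroup `P₀` of upper triangular matrices in `B`. -/
noncomputable def upperP₀ : Subgroup (iwahori p n) := (upperGL ℤ_[p] n).subgroupOf (iwahori p n)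

lemma proPIwahori_le_iwahori : proPIwahori p n ≤ iwahori p n := fun _ hg => hg.1

lemma lowerU_le_iwahori : lowerU p n ≤ iwahori p n := by
  intro g hg
  change reduction p n g ∈ lowerGL (ZMod p) n
  rw [mem_lowerGL]
  intro i j hij
  have h0 := (mem_lowerGL.1 hg.1) i j hij
  simp [h0]

variable {p n}

/-- The coercion of `G` into `B`. -/
noncomputable def proPIwahori.toB (h : proPIwahori p n) : iwahori p n :=
  Subgroup.inclusion (proPIwahori_le_iwahori p n) h

/-- The coercion of `U` into `B`. -/
noncomputable def lowerU.toB (A : lowerU p n) : iwahori p n :=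
  Subgroup.inclusion (lowerU_le_iwahori p n) A

/-- The entries of an element of `B`, as a point of `ℚ_p ^ (n × n)`. -/
noncomputable def entries (b : iwahori p n) : Fin n → Fin n → ℚ_[p] := fun i j => ((b.1 i j : ℤ_[p]) : ℚ_[p])

/-- The diagonal entries of an element of `P₀`, as units of `ℤ_p`. -/
noncomputable def diagUnit (b : upperP₀ p n) (i : Fin n) : ℤ_[p]ˣ :=
  (isUnit_diag (Subgroup.mem_subgroupOf.1 b.2) i).unit

/-- An integral matrix whose reduction modulo `p` is lower unipotent is an element of `G`. -/
lemma isUnit_of_reduction (M : Matrix (Fin n) (Fin n) ℤ_[p])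
    (h0 : ∀ i j, i < j → PadicInt.toZMod (M i j) = 0) (h1 : ∀ i, PadicInt.toZMod (M i i) = 1) :
    IsUnit M := by
  rw [Matrix.isUnit_iff_isUnit_det]
  have hdet : PadicInt.toZMod M.det = 1 := by
    rw [RingHom.map_det, Matrix.det_of_isLowerTriangular]
    · simp [h1]
    · intro i j hij
      simpa using h0 i j hij
  by_contra hM
  have : M.det ∈ RingHom.ker (PadicInt.toZMod (p := p)) := by
    rw [PadicInt.ker_toZMod]
    exact hM
  rw [RingHom.mem_ker, hdet] at this
  exact one_ne_zero this

/-- The matrix `1 + y E_{i,j}` for `i > j`, and `1 + p y E_{i,j}` for `i ≤ j`. -/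
noncomputable def oneParamMatrix (q : Fin n × Fin n) (y : ℤ_[p]) : Matrix (Fin n) (Fin n) ℤ_[p] :=
  1 + Matrix.single q.1 q.2 (if q.2 < q.1 then y else (p : ℤ_[p]) * y)

lemma oneParamMatrix_upper (q : Fin n × Fin n) (y : ℤ_[p]) (i j : Fin n) (hij : i < j) :
    PadicInt.toZMod (oneParamMatrix q y i j) = 0 := by
  obtain ⟨a, b⟩ := q
  by_cases h : a = i ∧ b = j
  · obtain ⟨rfl, rfl⟩ := h
    simp [oneParamMatrix, hij.not_gt, hij.ne]
  · simp [oneParamMatrix, Matrix.single, h, hij.ne]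

lemma oneParamMatrix_diag (q : Fin n × Fin n) (y : ℤ_[p]) (i : Fin n) :
    PadicInt.toZMod (oneParamMatrix q y i i) = 1 := by
  obtain ⟨a, b⟩ := q
  by_cases h : a = i ∧ b = i
  · obtain ⟨rfl, rfl⟩ := h
    simp [oneParamMatrix]
  · simp [oneParamMatrix, Matrix.single, h]

/-- The one-parameter families of `G`: `y ↦ 1 + y E_{i,j}` (`i > j`), `y ↦ 1 + p y E_{i,j}`
(`i < j`), and `y ↦ ` the diagonal matrix with `1 + p y` at the `i`-th place (`i = j`),
where `y ∈ ℤ_p`. -/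
noncomputable def oneParam (q : Fin n × Fin n) (y : ℤ_[p]) : proPIwahori p n :=
  ⟨(isUnit_of_reduction (oneParamMatrix q y) (oneParamMatrix_upper q y)
      (oneParamMatrix_diag q y)).unit, by
    refine ⟨?_, fun i => ?_⟩
    · rw [mem_lowerGL]
      intro i j hij
      simpa using oneParamMatrix_upper q y i j hij
    · simpa using oneParamMatrix_diag q y i⟩

variable (n) in
/-- The order of the one-parameter families: the lower unipotent ones in lexicographic order,
then the diagonal ones from top left to low right, then the upper unipotent ones in reversed
lexicographic order. -/
def orderedIndices : List (Fin n × Fin n) :=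
  ((List.finRange n).product (List.finRange n)).filter (fun q => q.2 < q.1) ++
    (List.finRange n).map (fun i => (i, i)) ++
      (((List.finRange n).product (List.finRange n)).filter (fun q => q.1 < q.2)).reverse

/-- The coordinates of the rigid-analytic group `G`: the ordered product of the one-parameter
families identifies `ℤ_p ^ (n × n)` with `G`. -/
noncomputable def coordG (x : Fin n × Fin n → ℤ_[p]) : proPIwahori p n :=
  ((orderedIndices n).map (fun q => oneParam q (x q))).prod

end Groups

/-! ### Tate algebras and globally analytic functions -/

section Tate

variable (p : ℕ) [Fact p.Prime] (K : Type*) [NormedField K] [NormedAlgebra ℚ_[p] K]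

/-- The Banach space `𝒜(ℤ_p ^ ι, V)` of globally analytic functions in finitely many variables:
families of coefficients `c_k ∈ V`, `k ∈ ℕ ^ ι`, tending to `0` as `|k| → ∞`, with the norm
`sup ‖c_k‖` (the index set is discrete). For `V = K` it is the Tate algebra. -/
abbrev TateSpace (ι : Type*) (V : Type*) [NormedAddCommGroup V] : Type _ := C₀(ι → ℕ, V)

/-- `∑_k x^k c_k = v`: the power series with coefficients `c` takes the value `v` at the point
`x ∈ ℤ_p ^ ι`. -/
def HasValue {ι : Type*} [Fintype ι] {V : Type*} [NormedAddCommGroup V] [NormedSpace K V]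
    (c : TateSpace ι V) (x : ι → ℤ_[p]) (v : V) : Prop :=
  HasSum (fun k : ι → ℕ => algebraMap ℚ_[p] K ((∏ i, x i ^ k i : ℤ_[p]) : ℚ_[p]) • c k) v

end Tate

/-! ### Globally analytic and admissible representations of `G` -/

section Representations

variable {p : ℕ} [Fact p.Prime] {n : ℕ} {K : Type*} [NormedField K] [NormedAlgebra ℚ_[p] K]
  {V : Type*} [NormedAddCommGroup V] [NormedSpace K V]

/-- The representation `π` of `G` on the Banach space `V` is globally analytic: for each `v`,
the orbit map `g ↦ π(g) v` is a power series in the coordinates of `G`, with coefficients in `V`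
tending to `0`. -/
def IsGloballyAnalyticRep (π : proPIwahori p n →* (V →L[K] V)) : Prop :=
  ∀ v : V, ∃ c : TateSpace (Fin n × Fin n) V,
    ∀ x : Fin n × Fin n → ℤ_[p], HasValue p K c x (π (coordG x) v)

variable (K n) in
/-- The Tate algebra `𝒜(G, K)` of globally analytic functions on `G`. -/
abbrev AnalyticFunctionsG : Type _ := TateSpace (Fin n × Fin n) K

variable (K n) in
/-- The space `D(G, K)` of globally analytic distributions: the continuous dual of `𝒜(G, K)`. -/
abbrev DistributionsG : Type _ := AnalyticFunctionsG n K →L[K] K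

/-- `F ∈ 𝒜(G, K)` is the matrix coefficient `g ↦ ℓ(π(g⁻¹) v)`. -/
def IsMatrixCoefficient (π : proPIwahori p n →* (V →L[K] V)) (l : V →L[K] K) (v : V)
    (F : AnalyticFunctionsG n K) : Prop :=
  ∀ x : Fin n × Fin n → ℤ_[p], HasValue p K F x (l (π (coordG x)⁻¹ v))

/-- A globally analytic Banach representation `V` is admissible when its continuous dual `V'` is a
finitely generated left module over `D(G, K)` (with convolution). The scalar action
`D(G, K) × V' → V'` is `(μ ⋆ ℓ)(v) = μ(g ↦ ℓ(π(g⁻¹) v))`; the condition says that there are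
`ℓ_1, …, ℓ_m ∈ V'` such that every element of `V'` is `∑ μ_i ⋆ ℓ_i` for suitable `μ_i`. -/
def IsAdmissibleRep (π : proPIwahori p n →* (V →L[K] V)) : Prop :=
  IsGloballyAnalyticRep π ∧
    ∃ (m : ℕ) (l : Fin m → (V →L[K] K)), ∀ l' : V →L[K] K,
      ∃ μ : Fin m → DistributionsG n K, ∀ v : V,
        ∃ F : Fin m → AnalyticFunctionsG n K,
          (∀ i, IsMatrixCoefficient π (l i) v (F i)) ∧ l' v = ∑ i, μ i (F i)

end Representations

/-! ### Analytic characters and the induced representation -/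

section Induced

variable {p : ℕ} [Fact p.Prime] {n : ℕ} {K : Type*} [NormedField K] [NormedAlgebra ℚ_[p] K]

/-- The character `θ` of `ℤ_pˣ` is locally analytic, with derivative `c` at `1`. -/
def IsLocallyAnalyticChar (θ : ℤ_[p]ˣ →* Kˣ) (c : K) : Prop :=
  ∃ F : ℚ_[p] → K, (∀ t : ℤ_[p]ˣ, AnalyticAt ℚ_[p] F ((t : ℤ_[p]) : ℚ_[p]) ∧
    F ((t : ℤ_[p]) : ℚ_[p]) = (θ t : K)) ∧ HasDerivAt F c 1

/-- The restriction of `θ` to `1 + p ℤ_p` is a globally analytic function: `θ(1 + p u)` is a power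
series in `u ∈ ℤ_p` whose coefficients tend to `0`. -/
def IsAnalyticOnOneUnits (θ : ℤ_[p]ˣ →* Kˣ) : Prop :=
  ∃ a : ℕ → K, Tendsto a atTop (𝓝 0) ∧
    ∀ (u : ℤ_[p]) (t : ℤ_[p]ˣ), (t : ℤ_[p]) = 1 + (p : ℤ_[p]) * u →
      HasSum (fun m : ℕ => a m * algebraMap ℚ_[p] K (u : ℚ_[p]) ^ m) (θ t : K)

/-- The value group of a normed field. -/
noncomputable def valueGroup (F : Type*) [NormedField F] : Subgroup ℝˣ :=
  (Units.map (normHom : F →*₀ ℝ).toMonoidHom).range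

variable (p K) in
/-- The ramification index `e(K/ℚ_p)`: the index of the value group of `ℚ_p` in that of `K`. -/
noncomputable def ramificationIndex : ℕ := (valueGroup ℚ_[p]).relIndex (valueGroup K)

variable (p) in
/-- `r < v_p(c)`, where `v_p` is the valuation of `K` with `v_p(p) = 1` and `v_p(0) = ∞`. -/
def LtValuation (r : ℝ) (c : K) : Prop := c = 0 ∨ r < -Real.logb p ‖c‖

/-- The character `χ = (χ_1, …, χ_n)` of `T₀`, extended to `P₀` through the diagonal. -/
noncomputable def charP₀ (χ : Fin n → (ℤ_[p]ˣ →* Kˣ)) (b : upperP₀ p n) : K :=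
  ∏ i, (χ i (diagUnit b i) : K)

/-- Locally analytic functions on `B`: near each point of `B` they are given by a convergent power
series in the matrix entries. -/
def IsLocallyAnalyticOnB (f : iwahori p n → K) : Prop :=
  ∃ F : (Fin n → Fin n → ℚ_[p]) → K,
    ∀ b, AnalyticAt ℚ_[p] F (entries b) ∧ F (entries b) = f b

/-- The locally analytic induced representation: locally analytic `f : B → K` with
`f(g b) = χ(b⁻¹) f(g)` for `b ∈ P₀`, `g ∈ B`. -/
def indLoc (χ : Fin n → (ℤ_[p]ˣ →* Kˣ)) : Submodule K (iwahori p n → K) where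
  carrier := {f | IsLocallyAnalyticOnB f ∧
    ∀ (g : iwahori p n) (b : upperP₀ p n), f (g * b) = charP₀ χ b⁻¹ * f g}
  add_mem' := by
    rintro f f' ⟨⟨F, hF⟩, hf⟩ ⟨⟨F', hF'⟩, hf'⟩
    refine ⟨⟨F + F', fun b => ⟨(hF b).1.add (hF' b).1, ?_⟩⟩, fun g b => ?_⟩
    · simp [(hF b).2, (hF' b).2]
    · simp [hf, hf', mul_add]
  zero_mem' := ⟨⟨fun _ => 0, fun _ => ⟨analyticAt_const, rfl⟩⟩, fun _ _ => by simp⟩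
  smul_mem' := by
    rintro a f ⟨⟨F, hF⟩, hf⟩
    refine ⟨⟨fun x => a * F x, fun b => ⟨analyticAt_const.mul (hF b).1, ?_⟩⟩, fun g b => ?_⟩
    · simp [(hF b).2]
    · simp only [Pi.smul_apply, smul_eq_mul, hf]
      ring

variable (n) in
/-- The positions strictly below the diagonal; there are `n (n - 1) / 2` of them. -/
abbrev LowerIndex : Type := {q : Fin n × Fin n // q.2 < q.1}

/-- The coordinates `a_{i,j}`, `i > j`, of `A ∈ U`. -/
noncomputable def coordU (A : lowerU p n) : LowerIndex n → ℤ_[p] := fun q => A.1 q.1.1 q.1.2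

variable (n K) in
/-- The Tate algebra `𝒜(U, K) = 𝒜(ℤ_p ^ (n (n - 1) / 2), K)`. -/
abbrev AnalyticFunctionsU : Type _ := TateSpace (LowerIndex n) K

/-- `c ∈ 𝒜(U, K)` is the power series expansion of the restriction of `f : B → K` to `U`. -/
def IsExpansionOnU (c : AnalyticFunctionsU n K) (f : iwahori p n → K) : Prop :=
  ∀ A : lowerU p n, HasValue p K c (coordU A) (f (lowerU.toB A))

/-- The space of globally analytic vectors of the induced representation: those
elements of the locally analytic induced representation whose restriction to `U` is globally
analytic. -/
def ind (χ : Fin n → (ℤ_[p]ˣ →* Kˣ)) : Submodule K (iwahori p n → K) where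
  carrier := {f | f ∈ indLoc χ ∧ ∃ c : AnalyticFunctionsU n K, IsExpansionOnU c f}
  add_mem' := by
    rintro f f' ⟨hf, c, hc⟩ ⟨hf', c', hc'⟩
    refine ⟨add_mem hf hf', c + c', fun A => ?_⟩
    have := (hc A).add (hc' A)
    simpa [HasValue, mul_add] using this
  zero_mem' := ⟨zero_mem _, 0, fun A => by simp [HasValue, hasSum_zero]⟩
  smul_mem' := by
    rintro a f ⟨hf, c, hc⟩
    refine ⟨Submodule.smul_mem _ a hf, a • c, fun A => ?_⟩
    have := (hc A).mul_left a
    simpa [HasValue, mul_left_comm] using this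

/-- The left translate `b ↦ f(h⁻¹ b)` of a function on `B` by `h ∈ G`. -/
noncomputable def leftTranslate (h : proPIwahori p n) (f : iwahori p n → K) : iwahori p n → K :=
  fun b => f ((proPIwahori.toB h)⁻¹ * b)

end Induced

end IwahoriSeries

open IwahoriSeries

/-! Write `R` for the ring of functions `ℤ_p^ι → ℤ_p` given by power series with coefficients in the
unit ball of `K` that tend to `0` (`tateRing`). A geometric series shows that `1 + p R` consists of
units, so reduction modulo `p` is a local homomorphism on `R` and Gaussian elimination works over
`R` itself: a matrix over `R` that is lower unipotent modulo `p` factors as `u b`, with `u` lower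
unipotent, `b` upper triangular and the diagonal of `b⁻¹` in `1 + p R`. For `v ∈ 𝒜(U, K)` let `f_v(u
t) = χ(t⁻¹) v(u)`. Along an analytic family `M(x)` of elements of `G` this gives `f_v(M(x)) = ∏
χ_i(1 + p w_i(x)) · v(u(x))`, which is globally analytic in `x` as soon as each `χ_i` is analytic on
`1 + p ℤ_p`, with norm at most a constant times `‖v‖`. This is `exists_isTate_indFun`, the engine of
the proof.

The assertions about `ind χ` come from applying it to suitable families. The family `u₀ (1 + p X)`
shows that `f_v` is locally analytic, hence restriction to `U` is onto. The family `h⁻¹ u(y)` gives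
stability under `G` and continuity of translation. The family `g(x)⁻¹ u(y)`, analytic in both groups
of variables, gives global analyticity of the orbit maps after currying (`exists_curry`).
Coefficients are determined by values (`tate_ext`), so identities in `𝒜(U, K)` can be checked
pointwise.

For admissibility, `V'` is cyclic, generated by evaluation `δ` at `1 ∈ U`. The matrix coefficient
`δ(π(g⁻¹) v) = f_v(g)`, restricted to `U ⊂ G`, is `v` again, so `ℓ' = (ℓ' ∘ restriction) ⋆ δ`.

Analyticity of `χ_i` is assumed when `K` contains a primitive `p`-th root of unity. Otherwise the
equation `t F' = c F` makes the Taylor series at `1` binomial, and the bound on `c` makes it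
converge on all of `1 + p ℤ_p`. Its sum is multiplicative by the identity theorem and agrees with
`χ_i` near `1`. The quotient of the two then takes values in roots of unity of `p`-power order,
which must be `1` (`eq_powerSeries_of_eventually`). -/

namespace IwahoriSeries

/-! ### Evaluation of elements of the Tate algebra -/

section TateBasics

variable {p : ℕ} [Fact p.Prime] {K : Type*} [NormedField K] [NormedAlgebra ℚ_[p] K]
  {ι κ : Type*} {E : Type*} [NormedAddCommGroup E]

variable (p K) in
/-- The inclusion of `ℤ_p` in `K`. -/
noncomputable def padicEmb : ℤ_[p] →+* K := (algebraMap ℚ_[p] K).comp PadicInt.Coe.ringHom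

lemma padicEmb_apply (x : ℤ_[p]) : padicEmb p K x = algebraMap ℚ_[p] K (x : ℚ_[p]) := rfl

@[simp] lemma norm_padicEmb (x : ℤ_[p]) : ‖padicEmb p K x‖ = ‖x‖ := by
  rw [padicEmb_apply, norm_algebraMap', PadicInt.norm_def]

lemma zeroAtInfty_norm_le {α : Type*} [TopologicalSpace α] (f : C₀(α, E)) {C : ℝ} (hC : 0 ≤ C) :
    ‖f‖ ≤ C ↔ ∀ a, ‖f a‖ ≤ C := by
  rw [← ZeroAtInftyContinuousMap.norm_toBCF_eq_norm, BoundedContinuousFunction.norm_le hC]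
  rfl

lemma zeroAtInfty_norm_apply_le {α : Type*} [TopologicalSpace α] (f : C₀(α, E)) (a : α) :
    ‖f a‖ ≤ ‖f‖ := (zeroAtInfty_norm_le f (norm_nonneg f)).1 le_rfl a

/-- With this, a series in a Tate algebra converges as soon as its terms tend to `0`, and its norm
is bounded by the largest term. -/
instance {α : Type*} [TopologicalSpace α] [IsUltrametricDist E] : IsUltrametricDist C₀(α, E) := by
  refine IsUltrametricDist.isUltrametricDist_of_forall_norm_add_le_max_norm fun f g => ?_
  rw [zeroAtInfty_norm_le _ (le_max_of_le_left (norm_nonneg f))]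
  intro a
  exact (IsUltrametricDist.norm_add_le_max (f a) (g a)).trans
    (max_le_max (zeroAtInfty_norm_apply_le f a) (zeroAtInfty_norm_apply_le g a))

lemma tendsto_cofinite_zero_iff {α : Type*} {f : α → E} :
    Tendsto f cofinite (𝓝 0) ↔ ∀ ε > 0, {a | ε ≤ ‖f a‖}.Finite := by
  simp only [Metric.tendsto_nhds, dist_zero_right, eventually_cofinite, not_lt]

/-- Summation in a complete ultrametric group. -/
lemma summable_of_tendsto_cofinite [CompleteSpace E] [IsUltrametricDist E] {α : Type*} {f : α → E}
    (hf : Tendsto f cofinite (𝓝 0)) : Summable f :=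
  have : NonarchimedeanAddGroup E := IsUltrametricDist.nonarchimedeanAddGroup
  NonarchimedeanAddGroup.summable_of_tendsto_cofinite_zero hf

lemma norm_le_of_hasSum [IsUltrametricDist E] {α : Type*} {f : α → E} {v : E} (hf : HasSum f v)
    {C : ℝ} (hC : 0 ≤ C) (h : ∀ a, ‖f a‖ ≤ C) : ‖v‖ ≤ C := by
  rw [← hf.tsum_eq]
  exact (IsUltrametricDist.norm_tsum_le f).trans (Real.iSup_le h hC)

/-- The element of the Tate space with a given family of coefficients. -/
def tateMk [Finite ι] (c : (ι → ℕ) → E) (h : Tendsto c cofinite (𝓝 0)) : TateSpace ι E :=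
  ⟨⟨c, continuous_of_discreteTopology⟩, by rwa [cocompact_eq_cofinite]⟩

@[simp] lemma tateMk_apply [Finite ι] (c : (ι → ℕ) → E) (h : Tendsto c cofinite (𝓝 0))
    (k : ι → ℕ) : tateMk c h k = c k := rfl

lemma tendsto_coeff [Finite ι] (c : TateSpace ι E) : Tendsto c cofinite (𝓝 0) := by
  rw [← cocompact_eq_cofinite]
  exact c.zero_at_infty'

variable [Fintype ι] [Fintype κ]

lemma norm_padicEmb_le_one (x : ℤ_[p]) : ‖padicEmb p K x‖ ≤ 1 := by
  rw [norm_padicEmb]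
  exact PadicInt.norm_le_one x

lemma norm_padicEmb_smul_le [NormedSpace K E] (x : ℤ_[p]) (v : E) : ‖padicEmb p K x • v‖ ≤ ‖v‖ := by
  rw [norm_smul]
  exact mul_le_of_le_one_left (norm_nonneg _) (norm_padicEmb_le_one _)

variable [NormedSpace K E]

lemma hasValue_iff_hasSum {c : TateSpace ι E} {x : ι → ℤ_[p]} {v : E} :
    HasValue p K c x v ↔ HasSum (fun k : ι → ℕ => padicEmb p K (∏ i, x i ^ k i) • c k) v := Iff.rfl

lemma HasValue.norm_le [IsUltrametricDist E] {c : TateSpace ι E} {x : ι → ℤ_[p]} {v : E}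
    (h : HasValue p K c x v) : ‖v‖ ≤ ‖c‖ :=
  norm_le_of_hasSum h (norm_nonneg _) fun k =>
    (norm_padicEmb_smul_le _ _).trans (zeroAtInfty_norm_apply_le c k)

variable [CompleteSpace E] [IsUltrametricDist E]

lemma tate_summable (c : TateSpace ι E) (x : ι → ℤ_[p]) :
    Summable fun k : ι → ℕ => padicEmb p K (∏ i, x i ^ k i) • c k := by
  refine summable_of_tendsto_cofinite (squeeze_zero_norm (fun k => norm_padicEmb_smul_le _ _) ?_)
  simpa using (tendsto_coeff c).norm

variable (K) in
/-- Evaluation of elements of the Tate space at a point. -/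
noncomputable def tateEval (x : ι → ℤ_[p]) : TateSpace ι E →L[K] E :=
  LinearMap.mkContinuous
    { toFun := fun c => ∑' k : ι → ℕ, padicEmb p K (∏ i, x i ^ k i) • c k
      map_add' := fun c d => by
        rw [← (tate_summable c x).tsum_add (tate_summable d x)]
        simp
      map_smul' := fun a c => by
        rw [RingHom.id_apply, ← (tate_summable c x).tsum_const_smul]
        exact tsum_congr fun k => smul_comm _ _ _ } 1
    fun c => by
      rw [one_mul]
      exact HasValue.norm_le (tate_summable (K := K) c x).hasSum

lemma hasValue_tateEval (c : TateSpace ι E) (x : ι → ℤ_[p]) : HasValue p K c x (tateEval K x c) :=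
  (tate_summable (K := K) c x).hasSum

lemma hasValue_iff {c : TateSpace ι E} {x : ι → ℤ_[p]} {v : E} :
    HasValue p K c x v ↔ tateEval K x c = v :=
  ⟨fun h => (hasValue_tateEval c x).unique h, fun h => h ▸ hasValue_tateEval c x⟩

end TateBasics

/-! ### Globally analytic functions with a bound for their coefficients -/

section IsTate

variable {p : ℕ} [Fact p.Prime] {K : Type*} [NormedField K] [NormedAlgebra ℚ_[p] K]
  {ι κ : Type*} [Fintype ι] [Fintype κ]

/-- `F` is a globally analytic function with coefficients of norm at most `C`. -/
def IsTate (F : (ι → ℤ_[p]) → K) (C : ℝ) : Prop :=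
  ∃ c : TateSpace ι K, ‖c‖ ≤ C ∧ ∀ x, HasValue p K c x (F x)

lemma IsTate.mono {F : (ι → ℤ_[p]) → K} {C D : ℝ} (h : IsTate F C) (hCD : C ≤ D) : IsTate F D :=
  let ⟨c, hc, hv⟩ := h
  ⟨c, hc.trans hCD, hv⟩

lemma IsTate.nonneg {F : (ι → ℤ_[p]) → K} {C : ℝ} (h : IsTate F C) : 0 ≤ C :=
  let ⟨_, hc, _⟩ := h
  (norm_nonneg _).trans hc

lemma IsTate.const_mul {F : (ι → ℤ_[p]) → K} {C : ℝ} (h : IsTate F C) (a : K) :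
    IsTate (fun x => a * F x) (‖a‖ * C) := by
  obtain ⟨c, hc, hv⟩ := h
  refine ⟨a • c, ?_, fun x => ?_⟩
  · rw [norm_smul]
    gcongr
  · have := (hv x).const_smul a
    simpa [HasValue, mul_left_comm] using this

lemma IsTate.add [IsUltrametricDist K] {F G : (ι → ℤ_[p]) → K} {C : ℝ} (hF : IsTate F C)
    (hG : IsTate G C) : IsTate (fun x => F x + G x) C := by
  obtain ⟨c, hc, hv⟩ := hF
  obtain ⟨d, hd, hw⟩ := hG
  refine ⟨c + d, (IsUltrametricDist.norm_add_le_max c d).trans (max_le hc hd), fun x => ?_⟩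
  have := (hv x).add (hw x)
  simpa [HasValue, mul_add] using this

lemma IsTate.monomial (k : ι → ℕ) (a : K) :
    IsTate (fun x : ι → ℤ_[p] => padicEmb p K (∏ i, x i ^ k i) * a) ‖a‖ := by
  classical
  refine ⟨tateMk (Pi.single k a) ?_, ?_, fun x => ?_⟩
  · refine tendsto_nhds_of_eventually_eq ?_
    rw [eventually_cofinite]
    refine (Set.finite_singleton k).subset fun l hl => ?_
    by_contra h
    exact hl (by simp [Pi.single_eq_of_ne h])
  · rw [zeroAtInfty_norm_le _ (norm_nonneg a)]
    intro l
    by_cases h : l = k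
    · subst h
      simp
    · simp [Pi.single_eq_of_ne h]
  · rw [hasValue_iff_hasSum]
    convert hasSum_single k fun l hl => ?_ using 1
    · simp
    · simp [Pi.single_eq_of_ne hl]

lemma IsTate.const (a : K) : IsTate (fun _ : ι → ℤ_[p] => a) ‖a‖ := by
  simpa using IsTate.monomial (p := p) (0 : ι → ℕ) a

lemma IsTate.coord (i : ι) : IsTate (fun x : ι → ℤ_[p] => padicEmb p K (x i)) 1 := by
  classical
  have h := IsTate.monomial (p := p) (Pi.single i 1 : ι → ℕ) (1 : K)
  rw [norm_one] at h
  convert h using 2 with x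
  rw [Finset.prod_eq_single i]
  · simp
  · intro j _ hj
    simp [Pi.single_eq_of_ne hj]
  · simp

lemma tendsto_extend_zero {α β E : Type*} [NormedAddCommGroup E] {φ : α → β}
    (hφ : Function.Injective φ) {c : α → E} (hc : Tendsto c cofinite (𝓝 0)) :
    Tendsto (Function.extend φ c 0) cofinite (𝓝 0) := by
  rw [tendsto_cofinite_zero_iff] at hc ⊢
  intro ε hε
  refine ((hc ε hε).image φ).subset fun b hb => ?_
  by_cases h : ∃ a, φ a = b
  · obtain ⟨a, rfl⟩ := h
    refine ⟨a, ?_, rfl⟩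
    simpa [hφ.extend_apply] using hb
  · rw [Set.mem_ofPred_eq, Function.extend_apply' _ _ _ h] at hb
    simp only [Pi.zero_apply, norm_zero] at hb
    exact absurd hb hε.not_ge

/-- Multiplication by `x^k` only shifts the coefficients along `l ↦ k + l`. `IsTate.mul` expands one
factor into monomials and sums such shifts, which avoids convolutions of coefficient families. -/
lemma IsTate.monomial_mul {F : (ι → ℤ_[p]) → K} {C : ℝ} (h : IsTate F C) (k : ι → ℕ) :
    IsTate (fun x => padicEmb p K (∏ i, x i ^ k i) * F x) C := by
  have hC := h.nonneg
  obtain ⟨c, hc, hv⟩ := h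
  have hinj : Function.Injective fun l : ι → ℕ => k + l := add_right_injective k
  refine ⟨tateMk _ (tendsto_extend_zero hinj (tendsto_coeff c)), ?_, fun x => ?_⟩
  · rw [zeroAtInfty_norm_le _ hC]
    intro l
    rw [tateMk_apply]
    by_cases h : ∃ m, k + m = l
    · obtain ⟨m, rfl⟩ := h
      rw [hinj.extend_apply]
      exact (zeroAtInfty_norm_apply_le c m).trans hc
    · rw [Function.extend_apply' _ _ _ h]
      simpa using hC
  · rw [hasValue_iff_hasSum, ← hinj.hasSum_iff]
    · refine ((hv x).mul_left (padicEmb p K (∏ i, x i ^ k i))).congr_fun ?_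
      intro l
      simp only [Function.comp_apply, tateMk_apply]
      rw [hinj.extend_apply (⇑c)]
      simp only [Pi.add_apply, pow_add, Finset.prod_mul_distrib, map_mul, smul_eq_mul, mul_assoc,
        padicEmb_apply]
    · intro l hl
      rw [tateMk_apply, Function.extend_apply' _ _ _ (by simpa using hl)]
      simp

variable [CompleteSpace K] [IsUltrametricDist K]

/-- The coefficient families tend to `0` in norm, so they sum in the complete ultrametric Tate
algebra; evaluation is continuous and commutes with the sum. -/
lemma IsTate.hasSum {α : Type*} {F : α → (ι → ℤ_[p]) → K} {C : α → ℝ} {D : ℝ}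
    (hF : ∀ a, IsTate (F a) (C a)) (hC : Tendsto C cofinite (𝓝 0)) (hD : 0 ≤ D)
    (hCD : ∀ a, C a ≤ D) {G : (ι → ℤ_[p]) → K} (hG : ∀ x, HasSum (fun a => F a x) (G x)) :
    IsTate G D := by
  choose c hc hv using hF
  have hs : Summable c := summable_of_tendsto_cofinite (squeeze_zero_norm hc hC)
  refine ⟨∑' a, c a, norm_le_of_hasSum hs.hasSum hD fun a => (hc a).trans (hCD a), fun x => ?_⟩
  rw [hasValue_iff]
  have h := (tateEval K x).hasSum hs.hasSum
  exact h.unique ((hG x).congr_fun fun a => hasValue_iff.1 (hv a x))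

lemma IsTate.mul {F G : (ι → ℤ_[p]) → K} {C D : ℝ} (hF : IsTate F C) (hG : IsTate G D) :
    IsTate (fun x => F x * G x) (C * D) := by
  have hC := hF.nonneg
  have hD := hG.nonneg
  obtain ⟨c, hc, hv⟩ := hF
  refine IsTate.hasSum (F := fun k x => c k * (padicEmb p K (∏ i, x i ^ k i) * G x))
    (C := fun k => ‖c k‖ * D) (fun k => (hG.monomial_mul k).const_mul (c k)) ?_ (mul_nonneg hC hD)
    (fun k => ?_) fun x => ?_
  · simpa using ((tendsto_coeff c).norm).mul_const D
  · gcongr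
    exact (zeroAtInfty_norm_apply_le c k).trans hc
  · refine ((hv x).mul_right (G x)).congr_fun fun k => ?_
    simp only [smul_eq_mul, padicEmb_apply]
    ring

variable (p K ι) in
/-- The ring of `ℤ_p`-valued functions given by power series with coefficients of norm at most `1`
that tend to `0`. -/
def tateRing : Subring ((ι → ℤ_[p]) → ℤ_[p]) where
  carrier := {f | IsTate (fun x => padicEmb p K (f x)) 1}
  mul_mem' := fun {f g} hf hg => by
    simpa using IsTate.mul hf hg
  one_mem' := by
    simpa using IsTate.const (p := p) (ι := ι) (1 : K)
  add_mem' := fun {f g} hf hg => by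
    simpa using IsTate.add hf hg
  zero_mem' := by
    simpa using (IsTate.const (p := p) (ι := ι) (0 : K)).mono (by simp)
  neg_mem' := fun {f} hf => by
    simpa using IsTate.const_mul hf (-1)

lemma mem_tateRing {f : (ι → ℤ_[p]) → ℤ_[p]} :
    f ∈ tateRing p K ι ↔ IsTate (fun x => padicEmb p K (f x)) 1 := Iff.rfl

/-- Substitution is `∑ v_k W^k`: every `W^k` stays in the ring of functions of norm at most `1`, so
the terms are dominated by `‖v_k‖ → 0`. -/
lemma IsTate.tateEval_comp (v : TateSpace κ K) (W : κ → tateRing p K ι) :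
    IsTate (fun x => tateEval K (fun j => (W j).1 x) v) ‖v‖ := by
  refine IsTate.hasSum
    (F := fun k x => v k * padicEmb p K ((∏ j, W j ^ k j : tateRing p K ι).1 x))
    (C := fun k => ‖v k‖ * 1) (fun k => IsTate.const_mul (mem_tateRing.1 (Subtype.property _)) _)
    ?_ (norm_nonneg v) (fun k => ?_) fun x => ?_
  · simpa using (tendsto_coeff v).norm
  · rw [mul_one]
    exact zeroAtInfty_norm_apply_le v k
  · refine (hasValue_tateEval (K := K) v (fun j => (W j).1 x)).congr_fun fun k => ?_
    rw [smul_eq_mul, mul_comm, padicEmb_apply]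
    congr 4
    simp only [SubmonoidClass.coe_finsetProd, SubmonoidClass.coe_pow, Finset.prod_apply,
      Pi.pow_apply]
    rfl

end IsTate

/-! ### Power series expansions at the origin and uniqueness of coefficients -/

section Analytic

variable {p : ℕ} [Fact p.Prime] {K : Type*} [NormedField K] [NormedAlgebra ℚ_[p] K]
  {ι : Type*} [Fintype ι]

/-- The monomial `z ^ k` is the diagonal of a multilinear map of norm at most `1`. -/
lemma exists_multilinear_monomial (k : ι → ℕ) :
    ∃ q : (ι → ℚ_[p]) [×(∑ i, k i)]→L[ℚ_[p]] ℚ_[p],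
      (∀ z, ‖q z‖ ≤ ∏ j, ‖z j‖) ∧ ∀ y, q (fun _ => y) = ∏ i, y i ^ k i := by
  -- The `|k|` slots are split into blocks: `k i` of them read off the coordinate `i`.
  let e : Fin (∑ i, k i) ≃ Σ i, Fin (k i) := (Fintype.equivFinOfCardEq (by simp)).symm
  refine ⟨(ContinuousMultilinearMap.mkPiAlgebra ℚ_[p] (Fin (∑ i, k i))
    ℚ_[p]).compContinuousLinearMap
      fun j => ContinuousLinearMap.proj (R := ℚ_[p]) (φ := fun _ : ι => ℚ_[p]) (e j).1,
    fun z => ?_, fun y => ?_⟩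
  · simp only [ContinuousMultilinearMap.compContinuousLinearMap_apply,
      ContinuousMultilinearMap.mkPiAlgebra_apply, ContinuousLinearMap.proj_apply, norm_prod]
    exact Finset.prod_le_prod (fun _ _ => norm_nonneg _) fun j _ => norm_le_pi_norm (z j) _
  · simp only [ContinuousMultilinearMap.compContinuousLinearMap_apply,
      ContinuousMultilinearMap.mkPiAlgebra_apply, ContinuousLinearMap.proj_apply]
    rw [Fintype.prod_equiv e (fun j => y (e j).1) (fun s => y s.1) fun _ => rfl,
      ← Finset.univ_sigma_univ, Finset.prod_sigma]
    simp

variable [IsUltrametricDist K]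

/-- The homogeneous parts of an element of the Tate algebra, as multilinear maps. -/
lemma exists_homogeneous_part [DecidableEq ι] (c : TateSpace ι K) (m : ℕ) :
    ∃ q : (ι → ℚ_[p]) [×m]→L[ℚ_[p]] K, ‖q‖ ≤ ‖c‖ ∧
      ∀ y, q (fun _ => y) =
        ∑ k ∈ Finset.piAntidiag Finset.univ m, algebraMap ℚ_[p] K (∏ i, y i ^ k i) * c k := by
  -- Choosing maps for all `k` at once needs a default when `|k| ≠ m`, where the number of slots is
  -- wrong; it is `0`.
  have h : ∀ k : ι → ℕ, ∃ q : (ι → ℚ_[p]) [×m]→L[ℚ_[p]] ℚ_[p],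
      (∀ z, ‖q z‖ ≤ ∏ j, ‖z j‖) ∧
        (k ∈ Finset.piAntidiag Finset.univ m → ∀ y, q (fun _ => y) = ∏ i, y i ^ k i) := by
    intro k
    by_cases hk : ∑ i, k i = m
    · subst hk
      obtain ⟨q, h1, h2⟩ := exists_multilinear_monomial (p := p) k
      exact ⟨q, h1, fun _ => h2⟩
    · refine ⟨0, fun z => ?_, fun hk' => absurd (Finset.mem_piAntidiag.1 hk').1 hk⟩
      simpa using Finset.prod_nonneg fun j _ => norm_nonneg (z j)
  choose q hq1 hq2 using h
  let Q : (ι → ℚ_[p]) [×m]→L[ℚ_[p]] K :=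
    ∑ k ∈ Finset.piAntidiag Finset.univ m, (q k).smulRight (c k)
  have hQ : ∀ z, Q z = ∑ k ∈ Finset.piAntidiag Finset.univ m, algebraMap ℚ_[p] K (q k z) * c k := by
    intro z
    simp [Q, Algebra.smul_def]
  refine ⟨Q, ContinuousMultilinearMap.opNorm_le_bound (norm_nonneg c) fun z => ?_, fun y => ?_⟩
  · rw [hQ]
    have h0 : 0 ≤ ∏ j, ‖z j‖ := Finset.prod_nonneg fun j _ => norm_nonneg (z j)
    refine IsUltrametricDist.norm_sum_le_of_forall_le_of_nonneg
      (mul_nonneg (norm_nonneg c) h0) fun k _ => ?_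
    rw [norm_mul, norm_algebraMap', mul_comm]
    exact mul_le_mul (zeroAtInfty_norm_apply_le c k) (hq1 k z) (norm_nonneg _) (norm_nonneg _)
  · rw [hQ]
    exact Finset.sum_congr rfl fun k hk => by rw [hq2 k hk]

variable [CompleteSpace K]

/-- A globally analytic function has a power series expansion at the origin, whose terms are the
homogeneous parts. -/
theorem exists_hasFPowerSeriesAt [DecidableEq ι] (c : TateSpace ι K) {G : (ι → ℚ_[p]) → K}
    (hG : ∀ x : ι → ℤ_[p], HasValue p K c x (G fun i => (x i : ℚ_[p]))) :
    ∃ q : FormalMultilinearSeries ℚ_[p] (ι → ℚ_[p]) K, HasFPowerSeriesAt G q 0 ∧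
      ∀ m y, q m (fun _ => y) =
        ∑ k ∈ Finset.piAntidiag Finset.univ m, algebraMap ℚ_[p] K (∏ i, y i ^ k i) * c k := by
  choose q hq1 hq2 using exists_homogeneous_part (p := p) c
  refine ⟨q, ⟨1, ⟨?_, one_pos, fun {y} hy => ?_⟩⟩, hq2⟩
  -- By ultrametricity the bound `‖c‖` does not grow with the number of monomials of degree `m`, so
  -- the radius is at least `1`.
  · exact FormalMultilinearSeries.le_radius_of_bound q ‖c‖ (r := 1) fun m => by
      simpa using hq1 m
  · have hy' : ∀ i, ‖y i‖ ≤ 1 := fun i => (norm_le_pi_norm y i).trans (by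
      have : ‖y‖ₑ < 1 := by simpa using hy
      rw [← ofReal_norm, ← ENNReal.ofReal_one] at this
      exact ((ENNReal.ofReal_lt_ofReal_iff one_pos).1 this).le)
    let x : ι → ℤ_[p] := fun i => ⟨y i, hy' i⟩
    have h := (hG x).tsum_fiberwise fun k : ι → ℕ => ∑ i, k i
    rw [zero_add]
    refine h.congr_fun fun m => ?_
    have hs : (fun k : ι → ℕ => ∑ i, k i) ⁻¹' {m} =
        ((Finset.piAntidiag Finset.univ m : Finset (ι → ℕ)) : Set (ι → ℕ)) := by
      ext k
      simp
    rw [hq2, hs, Finset.tsum_subtype' (Finset.piAntidiag Finset.univ m) fun k : ι → ℕ =>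
      algebraMap ℚ_[p] K
        ((∏ i, x i ^ k i : ℤ_[p]) : ℚ_[p]) • c k]
    refine Finset.sum_congr rfl fun k _ => ?_
    rw [smul_eq_mul]
    have hx : ((∏ i, x i ^ k i : ℤ_[p]) : ℚ_[p]) = ∏ i, y i ^ k i := by
      refine (map_prod PadicInt.Coe.ringHom (fun i => x i ^ k i) Finset.univ).trans ?_
      exact Finset.prod_congr rfl fun i _ => map_pow PadicInt.Coe.ringHom (x i) (k i)
    rw [hx]

theorem analyticAt_zero_of_hasValue (c : TateSpace ι K) {G : (ι → ℚ_[p]) → K}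
    (hG : ∀ x : ι → ℤ_[p], HasValue p K c x (G fun i => (x i : ℚ_[p]))) :
    AnalyticAt ℚ_[p] G 0 := by
  classical
  obtain ⟨q, hq, _⟩ := exists_hasFPowerSeriesAt c hG
  exact ⟨q, hq⟩

/-- The coefficients of a globally analytic function that vanishes near the origin are zero. -/
theorem tate_eq_zero_of_eventually (c : TateSpace ι K)
    (h : ∀ᶠ x : ι → ℤ_[p] in 𝓝 0, HasValue p K c x 0) : c = 0 := by
  classical
  have hint : ∀ y : ι → ℚ_[p], (∀ i, ‖y i‖ ≤ 1) → ∃ x : ι → ℤ_[p], (fun i => (x i : ℚ_[p])) = y :=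
    fun y hy => ⟨fun i => ⟨y i, hy i⟩, rfl⟩
  let e : (ι → ℤ_[p]) → ι → ℚ_[p] := fun x i => (x i : ℚ_[p])
  have he : Function.Injective e := fun x y hxy => funext fun i => Subtype.ext (congrFun hxy i)
  -- The value off the integral points is immaterial, since `ℤ_p^ι` is a neighbourhood of `0`.
  let G : (ι → ℚ_[p]) → K := Function.extend e (fun x => tateEval K x c) 0
  have hG : ∀ x, HasValue p K c x (G fun i => (x i : ℚ_[p])) := fun x => by
    have : G (e x) = tateEval K x c := he.extend_apply _ _ x
    rw [show (fun i => (x i : ℚ_[p])) = e x from rfl, this]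
    exact hasValue_tateEval c x
  obtain ⟨q, hq, hq'⟩ := exists_hasFPowerSeriesAt c hG
  have hind : Topology.IsOpenEmbedding e := by
    have h1 : ∀ i : ι, Topology.IsOpenEmbedding ((↑) : ℤ_[p] → ℚ_[p]) := fun _ => PadicInt.isOpenEmbedding_coe
    exact Topology.IsOpenEmbedding.piMap h1
  have hG0 : G =ᶠ[𝓝 0] 0 := by
    have h0 : e 0 = 0 := by
      funext i
      simp [e]
    rw [← h0, ← hind.map_nhds_eq, EventuallyEq, eventually_map]
    filter_upwards [h] with x hx
    exact (hG x).unique hx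
  have hz := (hq.congr hG0).apply_eq_zero
  ext k
  -- The homogeneous part of degree `|k|` vanishes on all points with coordinates in the infinite
  -- subfield `ℚ_p`, so it is the zero polynomial, and `c k` is one of its coefficients.
  let P : MvPolynomial ι K := ∑ k ∈ Finset.piAntidiag Finset.univ (∑ i, k i),
    MvPolynomial.monomial (Finsupp.equivFunOnFinite.symm k) (c k)
  have hP : P = 0 := by
    refine MvPolynomial.funext_set (fun _ => Set.range (algebraMap ℚ_[p] K))
      (fun _ => Set.infinite_range_of_injective (algebraMap ℚ_[p] K).injective) fun z hz' => ?_
    choose y hy using fun i => hz' i (Set.mem_univ i)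
    have h1 := hz (∑ i, k i) y
    rw [hq'] at h1
    rw [map_zero, ← h1, map_sum]
    refine Finset.sum_congr rfl fun l _ => ?_
    rw [MvPolynomial.eval_monomial, mul_comm, Finsupp.prod_fintype _ _ (by simp)]
    simp [← hy]
  have h2 := congrArg (MvPolynomial.coeff (Finsupp.equivFunOnFinite.symm k)) hP
  rw [MvPolynomial.coeff_sum, Finset.sum_eq_single k] at h2
  · simpa using h2
  · intro l _ hl
    rw [MvPolynomial.coeff_monomial, if_neg]
    exact fun h => hl (Finsupp.equivFunOnFinite.symm.injective h)
  · intro hk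
    simp at hk

theorem tate_ext {c d : TateSpace ι K} (h : ∀ x : ι → ℤ_[p], tateEval K x c = tateEval K x d) :
    c = d := by
  rw [← sub_eq_zero]
  refine tate_eq_zero_of_eventually (p := p) _ (Eventually.of_forall fun x => ?_)
  rw [hasValue_iff, map_sub, h, sub_self]

end Analytic

/-! ### The decomposition of a matrix into a lower unipotent and an upper triangular one -/

section LowerUpper

variable {A A' : Type*} [CommRing A] [CommRing A'] {n : ℕ}

lemma mem_lowerUnipotentGL {g : GL (Fin n) A} :
    g ∈ lowerUnipotentGL A n ↔ (∀ i j, i < j → g i j = 0) ∧ ∀ i, g i i = 1 := Iff.rfl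

/-- The lower unipotent matrix with given entries below the diagonal. -/
def lowerMatrix (y : LowerIndex n → A) : Matrix (Fin n) (Fin n) A :=
  Matrix.of fun i j => if h : j < i then y ⟨(i, j), h⟩ else if i = j then 1 else 0

lemma lowerMatrix_below (y : LowerIndex n → A) (q : LowerIndex n) :
    lowerMatrix y q.1.1 q.1.2 = y q := by
  simp [lowerMatrix, q.2]

lemma lowerMatrix_above (y : LowerIndex n → A) {i j : Fin n} (h : i < j) :
    lowerMatrix y i j = 0 := by
  simp [lowerMatrix, h.not_gt, h.ne]

lemma lowerMatrix_diag (y : LowerIndex n → A) (i : Fin n) : lowerMatrix y i i = 1 := by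
  simp [lowerMatrix]

lemma det_lowerMatrix (y : LowerIndex n → A) : (lowerMatrix y).det = 1 := by
  rw [Matrix.det_of_isLowerTriangular _ fun i j h => lowerMatrix_above y h]
  simp [lowerMatrix_diag]

/-- The element of `U` with given entries. -/
noncomputable def lowerMk (y : LowerIndex n → A) : lowerUnipotentGL A n :=
  ⟨((Matrix.isUnit_iff_isUnit_det (lowerMatrix y)).2
      (by rw [det_lowerMatrix]; exact isUnit_one)).unit,
    mem_lowerUnipotentGL.2
      ⟨fun _ _ h => lowerMatrix_above y h, fun i => lowerMatrix_diag y i⟩⟩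

lemma coe_lowerMk (y : LowerIndex n → A) :
    ((lowerMk y).1 : Matrix (Fin n) (Fin n) A) = lowerMatrix y := rfl

lemma lowerMk_entries (g : lowerUnipotentGL A n) :
    lowerMk (fun q : LowerIndex n => g.1 q.1.1 q.1.2) = g := by
  refine Subtype.ext (Units.ext ?_)
  rw [coe_lowerMk]
  ext i j
  rcases lt_trichotomy i j with h | rfl | h
  · rw [lowerMatrix_above _ h]
    exact (g.2.1 h).symm
  · rw [lowerMatrix_diag]
    exact (g.2.2 i).symm
  · exact lowerMatrix_below _ ⟨(i, j), h⟩

lemma isUnit_diag_of_lower {g : GL (Fin n) A} (hg : g ∈ lowerGL A n) (i : Fin n) :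
    IsUnit (g i i) := by
  have h1 : g.1.det = ∏ j, g j j := Matrix.det_of_isLowerTriangular _ hg
  have h2 : IsUnit g.1.det := (Matrix.isUnit_iff_isUnit_det _).1 g.isUnit
  rw [h1] at h2
  exact isUnit_of_dvd_unit (Finset.dvd_prod_of_mem (fun j => g j j) (Finset.mem_univ i)) h2

lemma map_mem_lowerUnipotentGL (f : A →+* A') {g : GL (Fin n) A}
    (hg : g ∈ lowerUnipotentGL A n) :
    Matrix.GeneralLinearGroup.map f g ∈ lowerUnipotentGL A' n := by
  rw [mem_lowerUnipotentGL] at hg ⊢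
  refine ⟨fun i j h => ?_, fun i => ?_⟩
  · simp [hg.1 i j h]
  · simp [hg.2 i]

lemma map_mem_upperGL (f : A →+* A') {g : GL (Fin n) A} (hg : g ∈ upperGL A n) :
    Matrix.GeneralLinearGroup.map f g ∈ upperGL A' n := by
  rw [mem_upperGL] at hg ⊢
  intro i j h
  simp [hg i j h]

lemma eq_one_of_lower_of_upper {g : GL (Fin n) A} (hl : g ∈ lowerUnipotentGL A n)
    (hu : g ∈ upperGL A n) : g = 1 := by
  refine Units.ext ?_
  ext i j
  rcases lt_trichotomy i j with h | rfl | h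
  · rw [Units.val_one, Matrix.one_apply_ne h.ne]
    exact hl.1 h
  · rw [Units.val_one, Matrix.one_apply_eq]
    exact hl.2 i
  · rw [Units.val_one, Matrix.one_apply_ne h.ne']
    exact hu h

lemma lower_mul_upper_inj {u u' b b' : GL (Fin n) A} (hu : u ∈ lowerUnipotentGL A n)
    (hu' : u' ∈ lowerUnipotentGL A n) (hb : b ∈ upperGL A n) (hb' : b' ∈ upperGL A n)
    (h : u * b = u' * b') : u = u' ∧ b = b' := by
  have h1 : u'⁻¹ * u = b' * b⁻¹ := by
    rw [eq_mul_inv_iff_mul_eq, mul_assoc, h, inv_mul_cancel_left]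
  have h2 : u'⁻¹ * u = 1 :=
    eq_one_of_lower_of_upper (mul_mem (inv_mem hu') hu) (h1 ▸ mul_mem hb' (inv_mem hb))
  have h3 : u = u' := (inv_mul_eq_one.1 h2).symm
  exact ⟨h3, mul_left_cancel (h3 ▸ h)⟩

/-- A matrix that becomes lower triangular under a local homomorphism is the product of a lower
unipotent and an upper triangular matrix. -/
theorem exists_lower_mul_upper (φ : A →+* A') [IsLocalHom φ] (M : GL (Fin n) A)
    (hM : Matrix.GeneralLinearGroup.map φ M ∈ lowerGL A' n) :
    ∃ u ∈ lowerUnipotentGL A n, ∃ b ∈ upperGL A n, M = u * b := by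
  -- Gaussian elimination without pivoting: after `k` rounds the first `k` columns vanish below the
  -- diagonal.
  have key : ∀ k ≤ n, ∃ L ∈ lowerUnipotentGL A n, ∀ i j : Fin n, j.1 < k → j < i →
      (L * M) i j = 0 := by
    intro k
    induction k with
    | zero => exact fun _ => ⟨1, one_mem _, fun i j h => absurd h (Nat.not_lt_zero _)⟩
    | succ k ih =>
      intro hk
      obtain ⟨L, hL, hLM⟩ := ih (by omega)
      let k' : Fin n := ⟨k, hk⟩
      have hN : Matrix.GeneralLinearGroup.map φ (L * M) ∈ lowerGL A' n := by
        rw [map_mul]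
        exact mul_mem (map_mem_lowerUnipotentGL φ hL).1 hM
      set N := L * M with hNdef
      -- The image of `N` is invertible and lower triangular, so its diagonal consists of units;
      -- locality of `φ` lifts this to the pivot.
      have hpiv : IsUnit (N k' k') := by
        have h := isUnit_diag_of_lower hN k'
        rw [Matrix.GeneralLinearGroup.map_apply] at h
        exact isUnit_of_map_unit φ _ h
      obtain ⟨u, hu⟩ := hpiv
      let w : Fin n → A := fun i => if k' < i then -(N i k' * (u⁻¹ : Aˣ)) else 0
      let E := lowerMk fun q : LowerIndex n => if q.1.2 = k' then w q.1.1 else 0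
      have hE : ((E.1 : GL (Fin n) A) : Matrix (Fin n) (Fin n) A) =
          1 + Matrix.vecMulVec w (Pi.single k' 1) := by
        rw [coe_lowerMk]
        ext i j
        rw [Matrix.add_apply, Matrix.vecMulVec_apply]
        rcases lt_trichotomy i j with h | rfl | h
        · rw [lowerMatrix_above _ h, Matrix.one_apply_ne h.ne]
          by_cases hj : j = k'
          · subst hj
            simp [w, h.not_gt]
          · simp [Pi.single_eq_of_ne hj]
        · rw [lowerMatrix_diag, Matrix.one_apply_eq]
          by_cases hi : i = k'
          · subst hi
            simp [w]
          · simp [Pi.single_eq_of_ne hi]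
        · rw [lowerMatrix_below _ ⟨(i, j), h⟩, Matrix.one_apply_ne h.ne']
          by_cases hj : j = k'
          · subst hj
            simp
          · simp [hj]
      have hEN : ∀ i j, (E.1 * N) i j = N i j + w i * N k' j := by
        intro i j
        change (E.1.1 * N.1) i j = _
        rw [hE, add_mul, one_mul, Matrix.add_apply, Matrix.vecMulVec_mul, Matrix.vecMulVec_apply]
        simp
      refine ⟨E.1 * L, mul_mem E.2 hL, fun i j hj hij => ?_⟩
      rw [mul_assoc, ← hNdef, hEN]
      rcases Nat.lt_succ_iff_lt_or_eq.1 hj with h | h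
      -- Earlier columns stay cleared because the pivot row already vanishes there.
      · rw [hLM i j h hij, zero_add]
        by_cases hi : k' < i
        · rw [hLM k' j h (Fin.lt_def.2 h), mul_zero]
        · simp [w, hi]
      · have hjk : j = k' := Fin.ext h
        subst hjk
        simp [w, hij, ← hu]
  obtain ⟨L, hL, h⟩ := key n le_rfl
  exact ⟨L⁻¹, inv_mem hL, L * M, fun i j hij => h i j j.2 hij, (inv_mul_cancel_left L M).symm⟩

end LowerUpper

/-! ### Matrices that are lower unipotent modulo an element -/

section CongruenceGroup

variable {A A' : Type*} [CommRing A] [CommRing A'] {n : ℕ}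

variable (A n) in
/-- Invertible matrices that are lower unipotent modulo the ideal generated by `a`. -/
def lowerUnipotentMod (a : A) : Subgroup (GL (Fin n) A) :=
  (lowerUnipotentGL (A ⧸ Ideal.span {a}) n).comap
    (Matrix.GeneralLinearGroup.map (Ideal.Quotient.mk (Ideal.span {a})))

lemma mem_lowerUnipotentMod {a : A} {g : GL (Fin n) A} :
    g ∈ lowerUnipotentMod A n a ↔ (∀ i j, i < j → a ∣ g i j) ∧ ∀ i, a ∣ g i i - 1 := by
  rw [lowerUnipotentMod, Subgroup.mem_comap, mem_lowerUnipotentGL]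
  simp only [Matrix.GeneralLinearGroup.map_apply, Ideal.Quotient.eq_zero_iff_dvd]
  refine and_congr_right fun _ => forall_congr' fun i => ?_
  rw [← Ideal.Quotient.eq_zero_iff_dvd, map_sub, map_one, sub_eq_zero]

lemma lowerUnipotentGL_le_mod (a : A) : lowerUnipotentGL A n ≤ lowerUnipotentMod A n a :=
  fun _ hg => map_mem_lowerUnipotentGL _ hg

lemma map_mem_lowerUnipotentMod (f : A →+* A') {a : A} {g : GL (Fin n) A}
    (hg : g ∈ lowerUnipotentMod A n a) :
    Matrix.GeneralLinearGroup.map f g ∈ lowerUnipotentMod A' n (f a) := by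
  rw [mem_lowerUnipotentMod] at hg ⊢
  simp only [Matrix.GeneralLinearGroup.map_apply]
  refine ⟨fun i j h => map_dvd f (hg.1 i j h), fun i => ?_⟩
  simpa using map_dvd f (hg.2 i)

/-- The determinant is `1` modulo `a`. -/
lemma isUnit_of_lowerUnipotent_mod {a : A} [IsLocalHom (Ideal.Quotient.mk (Ideal.span {a}))]
    (M : Matrix (Fin n) (Fin n) A) (h0 : ∀ i j, i < j → a ∣ M i j) (h1 : ∀ i, a ∣ M i i - 1) :
    IsUnit M := by
  rw [Matrix.isUnit_iff_isUnit_det]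
  refine isUnit_of_map_unit (Ideal.Quotient.mk (Ideal.span {a})) _ ?_
  rw [RingHom.map_det, Matrix.det_of_isLowerTriangular]
  · have : ∀ i, Ideal.Quotient.mk (Ideal.span {a}) (M i i) = 1 := fun i => by
      rw [← sub_eq_zero, ← map_one (Ideal.Quotient.mk (Ideal.span {a})), ← map_sub,
        Ideal.Quotient.eq_zero_iff_dvd]
      exact h1 i
    simp [this]
  · intro i j hij
    exact (Ideal.Quotient.eq_zero_iff_dvd _ _).2 (h0 i j hij)

/-- The factors of a matrix that is lower unipotent modulo `a`. -/
lemma exists_lower_mul_upper_mod {a : A} [IsLocalHom (Ideal.Quotient.mk (Ideal.span {a}))]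
    {M : GL (Fin n) A} (hM : M ∈ lowerUnipotentMod A n a) :
    ∃ u ∈ lowerUnipotentGL A n, ∃ b ∈ upperGL A n, M = u * b ∧
      ∀ i, ∃ w, b⁻¹ i i = 1 + a * w := by
  obtain ⟨u, hu, b, hb, rfl⟩ := exists_lower_mul_upper (Ideal.Quotient.mk (Ideal.span {a})) M hM.1
  refine ⟨u, hu, b, hb, rfl, fun i => ?_⟩
  -- Both `M` and `u` lie in the congruence group, hence so does `b`. The inverse is the one
  -- recorded because `χ` is evaluated at `b⁻¹`.
  have hb' : b⁻¹ ∈ lowerUnipotentMod A n a :=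
    inv_mem ((Subgroup.mul_mem_cancel_left _ (lowerUnipotentGL_le_mod a hu)).1 hM)
  obtain ⟨w, hw⟩ := (mem_lowerUnipotentMod.1 hb').2 i
  exact ⟨w, by rw [← hw]; ring⟩

end CongruenceGroup

/-! ### Reduction modulo `p` -/

section PadicReduction

variable {p : ℕ} [Fact p.Prime] {n : ℕ}

lemma toZMod_eq_zero_iff {x : ℤ_[p]} : PadicInt.toZMod x = 0 ↔ (p : ℤ_[p]) ∣ x := by
  rw [← RingHom.mem_ker, PadicInt.ker_toZMod, PadicInt.maximalIdeal_eq_span_p,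
    Ideal.mem_span_singleton]

instance : IsLocalHom (PadicInt.toZMod (p := p)) where
  map_nonunit x hx := by
    by_contra h
    have : x ∈ RingHom.ker (PadicInt.toZMod (p := p)) := by
      rw [PadicInt.ker_toZMod]
      exact h
    exact hx.ne_zero this

lemma mem_proPIwahori {g : GL (Fin n) ℤ_[p]} :
    g ∈ proPIwahori p n ↔ g ∈ lowerUnipotentMod ℤ_[p] n (p : ℤ_[p]) := by
  rw [mem_lowerUnipotentMod, proPIwahori, Subgroup.mem_comap, mem_lowerUnipotentGL]
  simp only [Matrix.GeneralLinearGroup.map_apply, toZMod_eq_zero_iff]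
  refine and_congr_right fun _ => forall_congr' fun i => ?_
  rw [← toZMod_eq_zero_iff, map_sub, map_one, sub_eq_zero]

/-- The decomposition `B = U P₀`. -/
lemma exists_iwahori_decomposition (b : iwahori p n) :
    ∃ (u : lowerU p n) (t : upperP₀ p n), b = lowerU.toB u * t.1 := by
  obtain ⟨u, hu, t, ht, h⟩ := exists_lower_mul_upper PadicInt.toZMod b.1 b.2
  have htB : t ∈ iwahori p n := by
    have : t = u⁻¹ * b.1 := by rw [h, inv_mul_cancel_left]
    rw [this]
    exact mul_mem (inv_mem (lowerU_le_iwahori p n hu)) b.2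
  exact ⟨⟨u, hu⟩, ⟨⟨t, htB⟩, Subgroup.mem_subgroupOf.2 ht⟩, Subtype.ext h⟩

lemma iwahori_decomposition_inj {u u' : lowerU p n} {t t' : upperP₀ p n}
    (h : lowerU.toB u * t.1 = lowerU.toB u' * t'.1) : u = u' ∧ t = t' := by
  obtain ⟨h1, h2⟩ := lower_mul_upper_inj u.2 u'.2 (Subgroup.mem_subgroupOf.1 t.2)
    (Subgroup.mem_subgroupOf.1 t'.2) (congrArg Subtype.val h)
  exact ⟨Subtype.ext h1, Subtype.ext (Subtype.ext h2)⟩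

lemma coordU_lowerMk (y : LowerIndex n → ℤ_[p]) : coordU (lowerMk y : lowerU p n) = y :=
  funext fun q => lowerMatrix_below y q

lemma lowerMk_coordU (u : lowerU p n) : (lowerMk (coordU u) : lowerU p n) = u := lowerMk_entries u

end PadicReduction

/-! ### The ring of integral globally analytic functions -/

section TateRing

variable {p : ℕ} [Fact p.Prime] {K : Type*} [NormedField K] [NormedAlgebra ℚ_[p] K]
  [CompleteSpace K] [IsUltrametricDist K] {ι : Type*} [Fintype ι] {n : ℕ}

lemma norm_prime_lt_one : ‖(p : ℤ_[p])‖ < 1 := by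
  rw [PadicInt.norm_p]
  exact inv_lt_one_of_one_lt₀ (by exact_mod_cast (Fact.out : p.Prime).one_lt)

lemma tendsto_norm_prime_pow : Tendsto (fun m : ℕ => ‖(p : ℤ_[p])‖ ^ m) cofinite (𝓝 0) := by
  rw [Nat.cofinite_eq_atTop]
  exact tendsto_pow_atTop_nhds_zero_of_lt_one (norm_nonneg _) norm_prime_lt_one

lemma norm_prime_mul_lt_one (x : ℤ_[p]) : ‖(p : ℤ_[p]) * x‖ < 1 := by
  rw [norm_mul]
  exact (mul_le_of_le_one_right (norm_nonneg _) (PadicInt.norm_le_one x)).trans_lt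
    norm_prime_lt_one

lemma isUnit_one_add_prime_mul (x : ℤ_[p]) : IsUnit (1 + (p : ℤ_[p]) * x) := by
  rw [PadicInt.isUnit_iff]
  have h := norm_prime_mul_lt_one x
  rw [IsUltrametricDist.norm_add_eq_max_of_norm_ne_norm (by rw [norm_one]; exact h.ne'), norm_one,
    max_eq_left h.le]

/-- The pointwise inverse is `∑ (-p)^m w^m`, whose terms have norm at most `|p|^m`, so it is again
an integral analytic function. -/
lemma isUnit_tateRing_one_add (w : tateRing p K ι) : IsUnit (1 + (p : tateRing p K ι) * w) := by
  choose g hg using fun x => (isUnit_one_add_prime_mul (w.1 x)).exists_right_inv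
  have hgR : g ∈ tateRing p K ι := by
    refine IsTate.hasSum (F := fun (m : ℕ) x => padicEmb p K ((-p : ℤ_[p]) ^ m) *
      padicEmb p K ((w ^ m : tateRing p K ι).1 x)) (C := fun m => ‖(p : ℤ_[p])‖ ^ m)
      (fun m => ?_) tendsto_norm_prime_pow zero_le_one
      (fun m => pow_le_one₀ (norm_nonneg _) (PadicInt.norm_le_one _)) fun x => ?_
    · convert IsTate.const_mul (mem_tateRing.1 (w ^ m).2) (padicEmb p K ((-p : ℤ_[p]) ^ m))
      rw [mul_one, norm_padicEmb, norm_pow, norm_neg]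
    · have h1 : ‖padicEmb p K (-(p * w.1 x))‖ < 1 := by
        rw [norm_padicEmb, norm_neg]
        exact norm_prime_mul_lt_one _
      have h2 : padicEmb p K (g x) = (1 - padicEmb p K (-(p * w.1 x)))⁻¹ := by
        refine eq_inv_of_mul_eq_one_right ?_
        rw [← map_one (padicEmb p K), ← map_sub, ← map_mul, sub_neg_eq_add, hg]
      rw [h2]
      refine (hasSum_geometric_of_norm_lt_one h1).congr_fun fun m => ?_
      rw [← map_mul, ← map_pow, neg_mul_eq_neg_mul, mul_pow]
      rfl
  refine IsUnit.of_mul_eq_one (⟨g, hgR⟩ : tateRing p K ι) (Subtype.ext (funext fun x => ?_))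
  exact hg x

/-- This is what lets elimination run over the ring of functions, so that the factors of an analytic
family are themselves analytic. -/
instance : IsLocalHom (Ideal.Quotient.mk (Ideal.span {(p : tateRing p K ι)})) where
  map_nonunit a ha := by
    obtain ⟨b, hb⟩ := ha.exists_right_inv
    obtain ⟨b, rfl⟩ := Ideal.Quotient.mk_surjective b
    rw [← map_mul, ← sub_eq_zero, ← map_one (Ideal.Quotient.mk _), ← map_sub,
      Ideal.Quotient.eq_zero_iff_dvd] at hb
    obtain ⟨w, hw⟩ := hb
    have h : a * b = 1 + p * w := by rw [← hw]; ring
    exact isUnit_of_mul_isUnit_left (h ▸ isUnit_tateRing_one_add w)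

variable (K) in
/-- Evaluation at a point. -/
noncomputable def tateRingEval (x : ι → ℤ_[p]) : tateRing p K ι →+* ℤ_[p] :=
  (Pi.evalRingHom (fun _ => ℤ_[p]) x).comp (tateRing p K ι).subtype

lemma tateRingEval_apply (x : ι → ℤ_[p]) (f : tateRing p K ι) : tateRingEval K x f = f.1 x := rfl

variable (K) in
/-- The coordinate functions. -/
noncomputable def tateCoord (i : ι) : tateRing p K ι := ⟨fun x => x i, IsTate.coord i⟩

variable (p K ι) in
/-- The constant functions. -/
noncomputable def tateConst : ℤ_[p] →+* tateRing p K ι :=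
  (Pi.constRingHom (ι → ℤ_[p]) ℤ_[p]).codRestrict (tateRing p K ι) fun a =>
    (IsTate.const (padicEmb p K a)).mono (norm_padicEmb_le_one a)

variable (p K ι n) in
/-- Matrices of integral globally analytic functions that are lower unipotent modulo `p`. -/
noncomputable abbrev analyticMatrices : Subgroup (GL (Fin n) (tateRing p K ι)) :=
  lowerUnipotentMod (tateRing p K ι) n (p : tateRing p K ι)

lemma map_eval_mem (M : analyticMatrices p K ι n) (x : ι → ℤ_[p]) :
    Matrix.GeneralLinearGroup.map (tateRingEval K x) M.1 ∈ proPIwahori p n := by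
  rw [mem_proPIwahori]
  simpa using map_mem_lowerUnipotentMod (tateRingEval K x) M.2

/-- The value of an analytic family of elements of `G`. -/
noncomputable def evalMatrix (x : ι → ℤ_[p]) : analyticMatrices p K ι n →* proPIwahori p n :=
  ((Matrix.GeneralLinearGroup.map (tateRingEval K x)).comp (Subgroup.subtype _)).codRestrict _
    fun M => map_eval_mem M x

lemma coe_evalMatrix (x : ι → ℤ_[p]) (M : analyticMatrices p K ι n) :
    (evalMatrix x M).1 = Matrix.GeneralLinearGroup.map (tateRingEval K x) M.1 := rfl

/-- The constant family. -/
noncomputable def constMatrix (h : proPIwahori p n) : analyticMatrices p K ι n :=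
  ⟨Matrix.GeneralLinearGroup.map (tateConst p K ι) h.1, by
    simpa using map_mem_lowerUnipotentMod (tateConst p K ι) (mem_proPIwahori.1 h.2)⟩

lemma evalMatrix_constMatrix (x : ι → ℤ_[p]) (h : proPIwahori p n) :
    evalMatrix x (constMatrix (K := K) h) = h := by
  refine Subtype.ext (Units.ext ?_)
  ext i j
  rfl

/-- The family of lower unipotent matrices with given entries. -/
noncomputable def lowerFamily (y : LowerIndex n → tateRing p K ι) : analyticMatrices p K ι n :=
  ⟨(lowerMk y).1, lowerUnipotentGL_le_mod _ (lowerMk y).2⟩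

lemma map_lowerMk {A A' : Type*} [CommRing A] [CommRing A'] (f : A →+* A')
    (y : LowerIndex n → A) :
    Matrix.GeneralLinearGroup.map f (lowerMk y).1 = (lowerMk fun q => f (y q)).1 := by
  refine Units.ext ?_
  ext i j
  rw [Matrix.GeneralLinearGroup.map_apply, coe_lowerMk, coe_lowerMk]
  rcases lt_trichotomy i j with h | rfl | h
  · rw [lowerMatrix_above _ h, lowerMatrix_above _ h, map_zero]
  · rw [lowerMatrix_diag, lowerMatrix_diag, map_one]
  · rw [lowerMatrix_below _ ⟨(i, j), h⟩, lowerMatrix_below _ ⟨(i, j), h⟩]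

lemma toB_evalMatrix_lowerFamily (x : ι → ℤ_[p]) (y : LowerIndex n → tateRing p K ι) :
    proPIwahori.toB (evalMatrix x (lowerFamily y)) =
      lowerU.toB (lowerMk fun q => (y q).1 x) :=
  Subtype.ext (map_lowerMk (tateRingEval K x) y)

/-- The one-parameter families with analytic parameters. -/
noncomputable def oneParamFamily (q : Fin n × Fin n) (y : tateRing p K ι) :
    analyticMatrices p K ι n :=
  have h0 : ∀ i j, i < j → (p : tateRing p K ι) ∣
      (1 + Matrix.single q.1 q.2 (if q.2 < q.1 then y else p * y) :
        Matrix (Fin n) (Fin n) (tateRing p K ι)) i j := fun i j hij => by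
    rw [Matrix.add_apply, Matrix.one_apply_ne hij.ne, zero_add, Matrix.single_apply]
    split_ifs with h1 h2
    · obtain ⟨rfl, rfl⟩ := h1
      exact absurd h2 hij.not_gt
    · exact dvd_mul_right _ _
    · exact dvd_zero _
  have h1 : ∀ i, (p : tateRing p K ι) ∣
      (1 + Matrix.single q.1 q.2 (if q.2 < q.1 then y else p * y) :
        Matrix (Fin n) (Fin n) (tateRing p K ι)) i i - 1 := fun i => by
    rw [Matrix.add_apply, Matrix.one_apply_eq, add_sub_cancel_left, Matrix.single_apply]
    split_ifs with h1 h2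
    · obtain ⟨h3, h4⟩ := h1
      exact absurd h2 (by rw [h3, h4]; exact lt_irrefl i)
    · exact dvd_mul_right _ _
    · exact dvd_zero _
  ⟨(isUnit_of_lowerUnipotent_mod _ h0 h1).unit, mem_lowerUnipotentMod.2 ⟨h0, h1⟩⟩

lemma evalMatrix_oneParamFamily (x : ι → ℤ_[p]) (q : Fin n × Fin n) (y : tateRing p K ι) :
    evalMatrix x (oneParamFamily q y) = oneParam q (y.1 x) := by
  refine Subtype.ext (Units.ext ?_)
  ext i j
  change tateRingEval K x ((1 + Matrix.single q.1 q.2 (if q.2 < q.1 then y else p * y) :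
    Matrix (Fin n) (Fin n) (tateRing p K ι)) i j) = oneParamMatrix q (y.1 x) i j
  rw [oneParamMatrix, Matrix.add_apply, Matrix.add_apply, map_add]
  congr 1
  · rw [Matrix.one_apply, Matrix.one_apply]
    split_ifs <;> simp
  · rw [Matrix.single_apply, Matrix.single_apply]
    split_ifs <;> simp [tateRingEval_apply]

/-- The parametrization of `G` with analytic parameters. -/
noncomputable def coordFamily (y : Fin n × Fin n → tateRing p K ι) : analyticMatrices p K ι n :=
  ((orderedIndices n).map fun q => oneParamFamily q (y q)).prod

lemma evalMatrix_coordFamily (x : ι → ℤ_[p]) (y : Fin n × Fin n → tateRing p K ι) :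
    evalMatrix x (coordFamily y) = coordG fun q => (y q).1 x := by
  rw [coordFamily, map_list_prod, List.map_map, coordG]
  congr 1
  exact List.map_congr_left fun q _ => evalMatrix_oneParamFamily x q (y q)

end TateRing

/-! ### The function on `B` induced by a globally analytic function on `U` -/

section Character

variable {p : ℕ} [Fact p.Prime] {n : ℕ} {K : Type*} [NormedField K]

lemma coe_diagUnit (b : upperP₀ p n) (i : Fin n) : (diagUnit b i : ℤ_[p]) = b.1.1 i i := rfl

lemma diagUnit_mul (b b' : upperP₀ p n) (i : Fin n) :
    diagUnit (b * b') i = diagUnit b i * diagUnit b' i := by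
  refine Units.ext ?_
  rw [Units.val_mul, coe_diagUnit, coe_diagUnit, coe_diagUnit]
  change (b.1.1.1 * b'.1.1.1) i i = _
  rw [Matrix.mul_apply]
  refine Finset.sum_eq_single i (fun j _ hj => ?_) (by simp)
  rcases lt_or_gt_of_ne hj with h | h
  · have := (mem_upperGL.1 (Subgroup.mem_subgroupOf.1 b.2)) i j h
    simp only [this, zero_mul]
  · have := (mem_upperGL.1 (Subgroup.mem_subgroupOf.1 b'.2)) j i h
    simp only [this, mul_zero]

lemma charP₀_mul (χ : Fin n → (ℤ_[p]ˣ →* Kˣ)) (b b' : upperP₀ p n) :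
    charP₀ χ (b * b') = charP₀ χ b * charP₀ χ b' := by
  simp [charP₀, diagUnit_mul, Finset.prod_mul_distrib]

lemma charP₀_one (χ : Fin n → (ℤ_[p]ˣ →* Kˣ)) : charP₀ χ (1 : upperP₀ p n) = 1 := by
  have : ∀ i, diagUnit (1 : upperP₀ p n) i = 1 := fun i => Units.ext (by
    rw [coe_diagUnit]
    exact Matrix.one_apply_eq i)
  simp [charP₀, this]

variable [NormedAlgebra ℚ_[p] K] [CompleteSpace K] [IsUltrametricDist K]

/-- The function on `B` with `f(u t) = χ(t⁻¹) v(u)`. -/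
noncomputable def indFun (χ : Fin n → (ℤ_[p]ˣ →* Kˣ)) (v : AnalyticFunctionsU n K)
    (b : iwahori p n) : K :=
  charP₀ χ (exists_iwahori_decomposition b).choose_spec.choose⁻¹ *
    tateEval K (coordU (exists_iwahori_decomposition b).choose) v

/-- Uniqueness in `B = U P₀` identifies the chosen factors with the given ones. -/
lemma indFun_mul (χ : Fin n → (ℤ_[p]ˣ →* Kˣ)) (v : AnalyticFunctionsU n K) (u : lowerU p n)
    (t : upperP₀ p n) :
    indFun χ v (lowerU.toB u * t.1) = charP₀ χ t⁻¹ * tateEval K (coordU u) v := by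
  obtain ⟨h1, h2⟩ := iwahori_decomposition_inj
    (exists_iwahori_decomposition (lowerU.toB u * t.1)).choose_spec.choose_spec
  exact congrArg₂ (fun a b => charP₀ χ b⁻¹ * tateEval K (coordU a) v) h1.symm h2.symm

lemma indFun_lower (χ : Fin n → (ℤ_[p]ˣ →* Kˣ)) (v : AnalyticFunctionsU n K) (u : lowerU p n) :
    indFun χ v (lowerU.toB u) = tateEval K (coordU u) v := by
  have h := indFun_mul χ v u 1
  rwa [OneMemClass.coe_one, mul_one, inv_one, charP₀_one, one_mul] at h

lemma indFun_equivariant (χ : Fin n → (ℤ_[p]ˣ →* Kˣ)) (v : AnalyticFunctionsU n K)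
    (g : iwahori p n) (b : upperP₀ p n) :
    indFun χ v (g * b) = charP₀ χ b⁻¹ * indFun χ v g := by
  obtain ⟨u, t, rfl⟩ := exists_iwahori_decomposition g
  rw [mul_assoc, ← Subgroup.coe_mul, indFun_mul, indFun_mul, mul_inv_rev, charP₀_mul, mul_assoc]

/-- An equivariant function on `B` is determined by its expansion on `U`. -/
lemma eq_indFun {χ : Fin n → (ℤ_[p]ˣ →* Kˣ)} {f : iwahori p n → K} {c : AnalyticFunctionsU n K}
    (hf : ∀ (g : iwahori p n) (b : upperP₀ p n), f (g * b) = charP₀ χ b⁻¹ * f g)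
    (hc : IsExpansionOnU c f) : f = indFun χ c := by
  funext b
  obtain ⟨u, t, rfl⟩ := exists_iwahori_decomposition b
  rw [hf, indFun_mul, hasValue_iff.1 (hc u)]

end Character

/-! ### Induced functions along analytic families, and their local analyticity on `B`. -/

section AnalyticFamilies

variable {p : ℕ} [Fact p.Prime] {n : ℕ} {K : Type*} [NormedField K] [NormedAlgebra ℚ_[p] K]
  [CompleteSpace K] [IsUltrametricDist K] {ι : Type*} [Fintype ι]

lemma IsTate.prod {α : Type*} (s : Finset α) {F : α → (ι → ℤ_[p]) → K} {C : α → ℝ}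
    (h : ∀ a, IsTate (F a) (C a)) : IsTate (fun x => ∏ a ∈ s, F a x) (∏ a ∈ s, C a) := by
  classical
  induction s using Finset.induction_on with
  | empty => simpa using IsTate.const (p := p) (ι := ι) (1 : K)
  | insert a s ha ih =>
    simp only [Finset.prod_insert ha]
    exact (h a).mul ih

lemma hasSum_padic_powerSeries {a : ℕ → K} (ha : Tendsto a atTop (𝓝 0)) (u : ℤ_[p]) :
    HasSum (fun m => a m * padicEmb p K u ^ m) (∑' m, a m * padicEmb p K u ^ m) := by
  refine (summable_of_tendsto_cofinite ?_).hasSum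
  rw [Nat.cofinite_eq_atTop]
  refine squeeze_zero_norm (fun m => ?_) (by simpa using ha.norm)
  rw [norm_mul, norm_pow]
  exact mul_le_of_le_one_right (norm_nonneg _)
    (pow_le_one₀ (norm_nonneg _) (norm_padicEmb_le_one u))

/-- A power series in one integral variable composed with a globally analytic function. -/
lemma exists_isTate_powerSeries {a : ℕ → K}
    (ha : Tendsto a atTop (𝓝 0)) {g : ℤ_[p] → K}
    (hg : ∀ u, HasSum (fun m => a m * padicEmb p K u ^ m) (g u)) (w : tateRing p K ι) :
    ∃ D, IsTate (fun x => g (w.1 x)) D := by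
  obtain ⟨D, hD⟩ := ha.norm.bddAbove_range
  have hD' : ∀ m, ‖a m‖ ≤ D := fun m => hD ⟨m, rfl⟩
  refine ⟨D, IsTate.hasSum (F := fun m x => a m * padicEmb p K ((w ^ m : tateRing p K ι).1 x))
    (C := fun m => ‖a m‖ * 1) (fun m => IsTate.const_mul (mem_tateRing.1 (w ^ m).2) (a m)) ?_
    ((norm_nonneg _).trans (hD' 0)) (fun m => by rw [mul_one]; exact hD' m) fun x => ?_⟩
  · rw [Nat.cofinite_eq_atTop]
    simpa using ha.norm
  · refine (hg (w.1 x)).congr_fun fun m => ?_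
    rw [← map_pow]
    rfl

/-- An analytic character composed with an analytic family of elements of `1 + p ℤ_p`. -/
lemma IsAnalyticOnOneUnits.exists_isTate {θ : ℤ_[p]ˣ →* Kˣ} (hθ : IsAnalyticOnOneUnits θ)
    (w : tateRing p K ι) (t : (ι → ℤ_[p]) → ℤ_[p]ˣ) (ht : ∀ x, (t x : ℤ_[p]) = 1 + p * w.1 x) :
    ∃ D, IsTate (fun x => (θ (t x) : K)) D := by
  obtain ⟨a, ha, h⟩ := hθ
  obtain ⟨D, hD⟩ := exists_isTate_powerSeries ha (hasSum_padic_powerSeries ha) w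
  refine ⟨D, ?_⟩
  convert hD using 2 with x
  exact (h (w.1 x) (t x) (ht x)).unique (hasSum_padic_powerSeries ha (w.1 x))

/-- The induced function along an analytic family of elements of `G` is analytic. -/
theorem exists_isTate_indFun {χ : Fin n → (ℤ_[p]ˣ →* Kˣ)} (hχ : ∀ i, IsAnalyticOnOneUnits (χ i))
    (M : analyticMatrices p K ι n) :
    ∃ C, ∀ v, IsTate (fun x => indFun χ v (proPIwahori.toB (evalMatrix x M))) (C * ‖v‖) := by
  -- One factorization over the ring of functions specializes to the factorization at every point
  -- `x`.
  obtain ⟨u, hu, b, hb, hM, hw⟩ := exists_lower_mul_upper_mod M.2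
  choose w hw using hw
  let u' : (ι → ℤ_[p]) → lowerU p n := fun x =>
    ⟨Matrix.GeneralLinearGroup.map (tateRingEval K x) u, map_mem_lowerUnipotentGL _ hu⟩
  have hdec : ∀ x, (evalMatrix x M).1 = (u' x).1 *
      Matrix.GeneralLinearGroup.map (tateRingEval K x) b := fun x => by
    rw [coe_evalMatrix, hM, map_mul]
  have hbB : ∀ x, Matrix.GeneralLinearGroup.map (tateRingEval K x) b ∈ iwahori p n := fun x =>
    (Subgroup.mul_mem_cancel_left _ (lowerU_le_iwahori p n (u' x).2)).1
      (hdec x ▸ proPIwahori_le_iwahori p n (evalMatrix x M).2)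
  let t : (ι → ℤ_[p]) → upperP₀ p n := fun x =>
    ⟨⟨_, hbB x⟩, Subgroup.mem_subgroupOf.2 (map_mem_upperGL _ hb)⟩
  have hdec' : ∀ x, proPIwahori.toB (evalMatrix x M) = lowerU.toB (u' x) * (t x).1 :=
    fun x => Subtype.ext (hdec x)
  have hdiag : ∀ i x, (diagUnit (t x)⁻¹ i : ℤ_[p]) = 1 + p * (w i).1 x := fun i x => by
    have h1 : ((t x)⁻¹).1.1 = Matrix.GeneralLinearGroup.map (tateRingEval K x) b⁻¹ :=
      (map_inv _ b).symm
    rw [coe_diagUnit, h1, Matrix.GeneralLinearGroup.map_apply, hw, map_add, map_mul, map_one,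
      map_natCast, tateRingEval_apply]
  choose D hD using fun i =>
    (hχ i).exists_isTate (w i) (fun x => diagUnit (t x)⁻¹ i) (hdiag i)
  -- The constant comes from the character factor alone; its independence of `v` later gives
  -- continuity of translation.
  refine ⟨∏ i, D i, fun v => ?_⟩
  have h1 : IsTate (fun x => charP₀ χ (t x)⁻¹) (∏ i, D i) := IsTate.prod Finset.univ hD
  have h2 := IsTate.tateEval_comp v fun q : LowerIndex n => u q.1.1 q.1.2
  have h3 := h1.mul h2
  simp only [hdec', indFun_mul]
  exact h3

/-- The family `1 + p X` of all matrices congruent to `1` modulo `p`. -/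
noncomputable def oneAddPrimeFamily : analyticMatrices p K (Fin n × Fin n) n :=
  have h0 : ∀ i j, i < j → (p : tateRing p K (Fin n × Fin n)) ∣
      (1 + Matrix.of fun i j => p * tateCoord K (i, j) :
        Matrix (Fin n) (Fin n) (tateRing p K (Fin n × Fin n))) i j := fun i j hij => by
    rw [Matrix.add_apply, Matrix.one_apply_ne hij.ne, zero_add, Matrix.of_apply]
    exact dvd_mul_right _ _
  have h1 : ∀ i, (p : tateRing p K (Fin n × Fin n)) ∣
      (1 + Matrix.of fun i j => p * tateCoord K (i, j) :
        Matrix (Fin n) (Fin n) (tateRing p K (Fin n × Fin n))) i i - 1 := fun i => by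
    rw [Matrix.add_apply, Matrix.one_apply_eq, add_sub_cancel_left, Matrix.of_apply]
    exact dvd_mul_right _ _
  ⟨(isUnit_of_lowerUnipotent_mod _ h0 h1).unit, mem_lowerUnipotentMod.2 ⟨h0, h1⟩⟩

lemma evalMatrix_oneAddPrimeFamily (x : Fin n × Fin n → ℤ_[p]) :
    ((evalMatrix x (oneAddPrimeFamily (K := K))).1 : Matrix (Fin n) (Fin n) ℤ_[p]) =
      1 + (p : ℤ_[p]) • Matrix.of fun i j => x (i, j) := by
  ext i j
  change tateRingEval K x ((1 + Matrix.of fun i j => p * tateCoord K (i, j) :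
    Matrix (Fin n) (Fin n) (tateRing p K (Fin n × Fin n))) i j) = _
  rw [Matrix.add_apply, Matrix.add_apply, map_add]
  congr 1
  · rw [Matrix.one_apply, Matrix.one_apply]
    split_ifs <;> simp

lemma entries_injective : Function.Injective (entries (p := p) (n := n)) := fun _ _ h =>
  Subtype.ext (Units.ext (Matrix.ext fun i j => Subtype.ext (congrFun (congrFun h i) j)))

/-- The matrix over `ℚ_p` underlying an integral one. -/
noncomputable abbrev padicMatrix : GL (Fin n) ℤ_[p] →* GL (Fin n) ℚ_[p] :=
  Matrix.GeneralLinearGroup.map PadicInt.Coe.ringHom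

lemma analyticAt_entry_mul_mul (A B : Matrix (Fin n) (Fin n) ℚ_[p]) (i j : Fin n)
    (m₀ : Fin n → Fin n → ℚ_[p]) :
    AnalyticAt ℚ_[p] (fun m : Fin n → Fin n → ℚ_[p] => (A * Matrix.of m * B) i j) m₀ := by
  simp only [Matrix.mul_apply, Matrix.of_apply]
  have h : ∀ k l, AnalyticAt ℚ_[p] (fun m : Fin n → Fin n → ℚ_[p] => m k l) m₀ := fun k l =>
    ((ContinuousLinearMap.proj (R := ℚ_[p]) (φ := fun _ : Fin n => ℚ_[p]) l).comp
      (ContinuousLinearMap.proj (R := ℚ_[p]) (φ := fun _ : Fin n => Fin n → ℚ_[p]) k)).analyticAt m₀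
  exact Finset.analyticAt_fun_sum _ fun l _ =>
    (Finset.analyticAt_fun_sum _ fun k _ => analyticAt_const.mul (h k l)).mul analyticAt_const

/-- Near `b₀ = u₀ t₀` the points of `B` are `u₀ (1 + p X) t₀` with `X` integral. The factor `t₀`
comes out by equivariance, and `u₀ (1 + p X)` is an analytic family in `G`. -/
theorem indFun_isLocallyAnalyticOnB {χ : Fin n → (ℤ_[p]ˣ →* Kˣ)}
    (hχ : ∀ i, IsAnalyticOnOneUnits (χ i)) (v : AnalyticFunctionsU n K) :
    IsLocallyAnalyticOnB (indFun χ v) := by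
  refine ⟨Function.extend entries (indFun χ v) 0, fun b₀ =>
    ⟨?_, entries_injective.extend_apply _ _ b₀⟩⟩
  obtain ⟨u₀, t₀, hb₀⟩ := exists_iwahori_decomposition b₀
  let g₀ : proPIwahori p n := ⟨u₀.1, mem_proPIwahori.2 (lowerUnipotentGL_le_mod _ u₀.2)⟩
  let M : analyticMatrices p K (Fin n × Fin n) n := constMatrix g₀ * oneAddPrimeFamily
  obtain ⟨C, hC⟩ := exists_isTate_indFun hχ M
  obtain ⟨c, -, hc⟩ := hC v
  let e : (Fin n × Fin n → ℤ_[p]) → Fin n × Fin n → ℚ_[p] := fun x q => (x q : ℚ_[p])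
  have he : Function.Injective e := fun x y h => funext fun q => Subtype.ext (congrFun h q)
  let G : (Fin n × Fin n → ℚ_[p]) → K :=
    Function.extend e (fun x => indFun χ v (proPIwahori.toB (evalMatrix x M))) 0
  have hGe : ∀ x, G (e x) = indFun χ v (proPIwahori.toB (evalMatrix x M)) := he.extend_apply _ _
  have hG : AnalyticAt ℚ_[p] G 0 := analyticAt_zero_of_hasValue c fun x => by
    rw [show (fun i => (x i : ℚ_[p])) = e x from rfl, hGe]
    exact hc x
  let U := padicMatrix u₀.1
  let T := padicMatrix t₀.1.1
  -- The affine inverse of the chart: it solves `m = u₀ (1 + p X) t₀` for `X`.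
  let α : (Fin n → Fin n → ℚ_[p]) → Fin n × Fin n → ℚ_[p] := fun m q =>
    (p : ℚ_[p])⁻¹ * ((U⁻¹.1 * Matrix.of m * T⁻¹.1) q.1 q.2 -
      (1 : Matrix (Fin n) (Fin n) ℚ_[p]) q.1 q.2)
  have hp0 : (p : ℚ_[p]) ≠ 0 := by exact_mod_cast (Fact.out : p.Prime).ne_zero
  have hα : AnalyticAt ℚ_[p] α (entries b₀) := by
    rw [analyticAt_pi_iff]
    exact fun q => analyticAt_const.mul ((analyticAt_entry_mul_mul _ _ _ _ _).sub analyticAt_const)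
  have hα' : ∀ m x, α m = e x → m = entries (proPIwahori.toB (evalMatrix x M) * t₀.1) := by
    intro m x h
    have h1 : U⁻¹.1 * Matrix.of m * T⁻¹.1 =
        (padicMatrix (evalMatrix x (oneAddPrimeFamily (K := K))).1).1 := by
      ext i j
      have h2 := congrFun h (i, j)
      simp only [α, e] at h2
      rw [inv_mul_eq_iff_eq_mul₀ hp0, sub_eq_iff_eq_add'] at h2
      rw [h2]
      change _ = PadicInt.Coe.ringHom
        (((evalMatrix x (oneAddPrimeFamily (K := K))).1 : Matrix (Fin n) (Fin n) ℤ_[p]) i j)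
      rw [evalMatrix_oneAddPrimeFamily, Matrix.add_apply, map_add]
      congr 1
      · rw [Matrix.one_apply, Matrix.one_apply]
        split_ifs <;> simp
    have h2 : Matrix.of m = U.1 * (U⁻¹.1 * Matrix.of m * T⁻¹.1) * T.1 := by
      have hU : U.1 * U⁻¹.1 = 1 := U.mul_inv
      have hT : T⁻¹.1 * T.1 = 1 := T.inv_mul
      rw [mul_assoc, mul_assoc, mul_assoc, hT, mul_one, ← mul_assoc, hU, one_mul]
    rw [h1, ← Units.val_mul, ← Units.val_mul] at h2
    have h3 : U * padicMatrix (evalMatrix x (oneAddPrimeFamily (K := K))).1 * T =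
        padicMatrix (proPIwahori.toB (evalMatrix x M) * t₀.1).1 := by
      have : (evalMatrix x M) = g₀ * evalMatrix x (oneAddPrimeFamily (K := K)) := by
        rw [map_mul, evalMatrix_constMatrix]
      rw [this]
      change padicMatrix u₀.1 * _ * padicMatrix t₀.1.1 = _
      rw [← map_mul, ← map_mul]
      rfl
    rw [h3] at h2
    exact h2
  have hα0 : α (entries b₀) = 0 := by
    funext q
    have h1 : Matrix.of (entries b₀) = U.1 * T.1 := by
      have : padicMatrix b₀.1 = U * T := by
        rw [hb₀]
        exact map_mul padicMatrix u₀.1 t₀.1.1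
      rw [← Units.val_mul, ← this]
      rfl
    have h2 : U⁻¹.1 * (U.1 * T.1) * T⁻¹.1 = 1 := by
      have hU : U⁻¹.1 * U.1 = 1 := U.inv_mul
      have hT : T.1 * T⁻¹.1 = 1 := T.mul_inv
      rw [← mul_assoc, hU, one_mul, hT]
    simp only [α]
    rw [h1, h2, sub_self, mul_zero]
    rfl
  have hmain : AnalyticAt ℚ_[p] (fun m => charP₀ χ t₀⁻¹ * G (α m)) (entries b₀) :=
    analyticAt_const.mul (AnalyticAt.fun_comp (by rwa [hα0]) hα)
  refine hmain.congr ?_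
  have hball : ∀ᶠ m in 𝓝 (entries b₀), α m ∈ Metric.ball 0 1 :=
    hα.continuousAt.eventually_mem (by rw [hα0]; exact Metric.ball_mem_nhds 0 one_pos)
  filter_upwards [hball] with m hm
  rw [mem_ball_zero_iff] at hm
  let x : Fin n × Fin n → ℤ_[p] := fun q => ⟨α m q, ((norm_le_pi_norm (α m) q).trans_lt hm).le⟩
  have hx : α m = e x := rfl
  rw [hx, hGe, ← indFun_equivariant]
  conv_rhs => rw [hα' m x hx]
  exact (entries_injective.extend_apply _ _ _).symm

end AnalyticFamilies

/-! ### Analytic functions with values in a Tate algebra -/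

section Curry

variable {p : ℕ} [Fact p.Prime] {K : Type*} [NormedField K] [NormedAlgebra ℚ_[p] K]
  [CompleteSpace K] [IsUltrametricDist K] {ι κ : Type*} [Fintype ι] [Fintype κ]

/-- A function that is globally analytic in two groups of variables is a globally analytic
function of the first group with values in the Tate algebra of the second. -/
theorem exists_curry (c : TateSpace (ι ⊕ κ) K) (w : (ι → ℤ_[p]) → TateSpace κ K)
    (h : ∀ x y, HasValue p K c (Sum.elim x y) (tateEval K y (w x))) :
    ∃ c' : TateSpace ι (TateSpace κ K), ∀ x, HasValue p K c' x (w x) := by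
  have hinj : ∀ k : ι → ℕ, Function.Injective fun l : κ → ℕ => (Sum.elim k l : ι ⊕ κ → ℕ) :=
    fun k l l' hl => by
      funext j
      exact congrFun hl (Sum.inr j)
  -- The `k`-th coefficient collects all coefficients of `c` whose exponents in the first group are
  -- `k`.
  let d : (ι → ℕ) → TateSpace κ K := fun k =>
    tateMk (fun l => c (Sum.elim k l)) ((tendsto_coeff c).comp (hinj k).tendsto_cofinite)
  have hd : Tendsto d cofinite (𝓝 0) := by
    have hc := tendsto_cofinite_zero_iff.1 (tendsto_coeff c)
    rw [tendsto_cofinite_zero_iff]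
    intro ε hε
    -- Only finitely many coefficients of `c` have norm at least `ε / 2`; off the projection of
    -- their exponents every slice has norm at most `ε / 2 < ε`.
    refine ((hc (ε / 2) (half_pos hε)).image fun m i => m (Sum.inl i)).subset fun k hk => ?_
    by_contra hk'
    have : ‖d k‖ ≤ ε / 2 := by
      rw [zeroAtInfty_norm_le _ (half_pos hε).le]
      intro l
      by_contra hl
      exact hk' ⟨Sum.elim k l, (not_le.1 hl).le, rfl⟩
    have hk2 : ε ≤ ‖d k‖ := hk
    linarith
  refine ⟨tateMk d hd, fun x => ?_⟩
  rw [hasValue_iff]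
  refine tate_ext (p := p) fun y => ?_
  have h1 : HasSum (fun k : ι → ℕ => padicEmb p K (∏ i, x i ^ k i) • tateEval K y (d k))
      (tateEval K y (tateEval K x (tateMk d hd))) := by
    have h0 := (tateEval K y).hasSum (hasValue_tateEval (K := K) (tateMk d hd) x)
    refine h0.congr_fun fun k => ?_
    exact ((tateEval K y).map_smul _ _).symm
  have h2 : HasSum (fun kl : (ι → ℕ) × (κ → ℕ) => padicEmb p K (∏ i, x i ^ kl.1 i) •
      (padicEmb p K (∏ j, y j ^ kl.2 j) • d kl.1 kl.2)) (tateEval K y (w x)) := by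
    have h0 := h x y
    rw [hasValue_iff_hasSum, ← (Equiv.sumArrowEquivProdArrow ι κ ℕ).symm.hasSum_iff] at h0
    refine h0.congr_fun fun kl => ?_
    have hk : ∀ i, (Equiv.sumArrowEquivProdArrow ι κ ℕ).symm kl (Sum.inl i) = kl.1 i :=
      fun _ => rfl
    have hl : ∀ j, (Equiv.sumArrowEquivProdArrow ι κ ℕ).symm kl (Sum.inr j) = kl.2 j :=
      fun _ => rfl
    rw [Function.comp_apply, Fintype.prod_sum_type, map_mul, mul_smul]
    simp only [Sum.elim_inl, Sum.elim_inr, hk, hl]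
    rfl
  -- Summing the double series first over the exponents of `y` gives the iterated series.
  have h3 := h2.prod_fiberwise fun k =>
    (hasValue_tateEval (K := K) (d k) y).const_smul (padicEmb p K (∏ i, x i ^ k i))
  exact h1.unique h3

end Curry

/-! ### Restriction of power series to coordinate subspaces. -/

section Restrict

variable {p : ℕ} [Fact p.Prime] {K : Type*} [NormedField K] [NormedAlgebra ℚ_[p] K]
  {ι : Type*} [Fintype ι]

/-- Restriction of globally analytic functions to the subspace where the coordinates outside a
subset vanish. -/
noncomputable def tateRestrict (P : ι → Prop) :
    TateSpace ι K →L[K] TateSpace {i // P i} K :=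
  have hinj : Function.Injective fun k : {i // P i} → ℕ =>
      Function.extend (Subtype.val : {i // P i} → ι) k 0 :=
    Function.extend_injective Subtype.val_injective (0 : ι → ℕ)
  LinearMap.mkContinuous
    { toFun := fun c => tateMk (fun k => c (Function.extend Subtype.val k 0))
        ((tendsto_coeff c).comp hinj.tendsto_cofinite)
      map_add' := fun c d => rfl
      map_smul' := fun a c => rfl } 1
    fun c => by
      rw [one_mul, zeroAtInfty_norm_le _ (norm_nonneg c)]
      exact fun k => zeroAtInfty_norm_apply_le c _

lemma tateRestrict_apply (P : ι → Prop) (c : TateSpace ι K) (k : {i // P i} → ℕ) :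
    tateRestrict P c k = c (Function.extend Subtype.val k 0) := rfl

/-- A monomial with a positive exponent at a coordinate set to `0` drops out; the others survive
because `0 ^ 0 = 1`. -/
lemma HasValue.tateRestrict {P : ι → Prop} [Fintype {i // P i}] {c : TateSpace ι K}
    {y : {i // P i} → ℤ_[p]} {v : K} (h : HasValue p K c (Function.extend Subtype.val y 0) v) :
    HasValue p K (tateRestrict P c) y v := by
  have hinj : Function.Injective fun k : {i // P i} → ℕ =>
      Function.extend (Subtype.val : {i // P i} → ι) k 0 :=
    Function.extend_injective Subtype.val_injective (0 : ι → ℕ)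
  have hout : ∀ {β : Type} [Zero β] (z : {i // P i} → β) (i : ι), ¬ P i →
      Function.extend Subtype.val z 0 i = 0 := fun z i hi =>
    Function.extend_apply' _ _ _ fun ⟨j, hj⟩ => hi (hj ▸ j.2)
  rw [hasValue_iff_hasSum, ← hinj.hasSum_iff] at h
  · refine h.congr_fun fun k => ?_
    have hprod : ∏ i, Function.extend Subtype.val y 0 i ^
        (Function.extend Subtype.val k (0 : ι → ℕ)) i = ∏ i, y i ^ k i := by
      symm
      refine Finset.prod_of_injOn Subtype.val Subtype.val_injective.injOn
        (fun _ _ => Finset.mem_coe.2 (Finset.mem_univ _)) (fun i _ hi => ?_) fun i _ => ?_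
      · rw [hout k i fun hP => hi ⟨⟨i, hP⟩, by simp, rfl⟩, pow_zero]
      · rw [Subtype.val_injective.extend_apply, Subtype.val_injective.extend_apply]
    rw [Function.comp_apply, tateRestrict_apply, hprod]
    rfl
  · intro k hk
    obtain ⟨i, hi, hki⟩ : ∃ i, ¬ P i ∧ k i ≠ 0 := by
      by_contra hcon
      push Not at hcon
      refine hk ⟨fun i => k i, funext fun i => ?_⟩
      by_cases hi : P i
      · exact Subtype.val_injective.extend_apply (fun i : {i // P i} => k i) 0 ⟨i, hi⟩
      · exact (hout _ i hi).trans (hcon i hi).symm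
    rw [Finset.prod_eq_zero (Finset.mem_univ i) (by rw [hout y i hi, zero_pow hki]), map_zero,
      zero_smul]

end Restrict

/-! ### The coordinates of the lower unipotent matrices -/

section Coordinates

variable {p : ℕ} [Fact p.Prime] {n : ℕ}

lemma coe_oneParam (q : Fin n × Fin n) (y : ℤ_[p]) :
    ((oneParam q y).1 : Matrix (Fin n) (Fin n) ℤ_[p]) = oneParamMatrix q y := rfl

lemma oneParam_zero (q : Fin n × Fin n) : oneParam q (0 : ℤ_[p]) = 1 := by
  refine Subtype.ext (Units.ext ?_)
  rw [coe_oneParam, oneParamMatrix]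
  simp

/-- A product of elementary matrices in which no column index is a later row index. -/
lemma prod_one_add_single {A : Type*} [CommRing A] (y : Fin n × Fin n → A)
    (L : List (Fin n × Fin n)) (hL : L.Pairwise fun q q' => q.2 ≠ q'.1) :
    (L.map fun q => 1 + Matrix.single q.1 q.2 (y q)).prod =
      1 + (L.map fun q => Matrix.single q.1 q.2 (y q)).sum := by
  induction L with
  | nil => simp
  | cons q L ih =>
    rw [List.pairwise_cons] at hL
    have h0 : Matrix.single q.1 q.2 (y q) * (L.map fun q => Matrix.single q.1 q.2 (y q)).sum =
        0 := by
      rw [← List.sum_map_mul_left]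
      refine List.sum_eq_zero fun M hM => ?_
      obtain ⟨q', hq', rfl⟩ := List.mem_map.1 hM
      exact Matrix.single_mul_single_of_ne _ _ _ _ (hL.1 q' hq') _
    rw [List.map_cons, List.prod_cons, ih hL.2, List.map_cons, List.sum_cons, add_mul, one_mul,
      mul_add, mul_one, h0, add_zero]
    abel

variable (n) in
/-- The positions below the diagonal in lexicographic order. -/
abbrev lowerList : List (Fin n × Fin n) :=
  ((List.finRange n).product (List.finRange n)).filter fun q => q.2 < q.1

/-- In lexicographic order the row indices do not decrease, so a column index, being smaller than
its own row index, is smaller than every later one. -/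
lemma pairwise_lowerList : (lowerList n).Pairwise fun q q' => q.2 ≠ q'.1 := by
  have h1 : ((List.finRange n).product (List.finRange n)).Pairwise fun q q' => q.1 ≤ q'.1 := by
    rw [List.product, List.pairwise_flatMap]
    refine ⟨fun i _ => ?_, ?_⟩
    · rw [List.pairwise_map]
      exact List.pairwise_of_forall fun _ _ => le_rfl
    · refine (List.pairwise_lt_finRange n).imp fun {i j} hij q hq q' hq' => ?_
      obtain ⟨_, _, rfl⟩ := List.mem_map.1 hq
      obtain ⟨_, _, rfl⟩ := List.mem_map.1 hq'
      exact hij.le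
  have h2 : (lowerList n).Pairwise fun q q' => q.1 ≤ q'.1 := h1.filter _
  refine List.Pairwise.imp_of_mem (fun {q q'} hq _ h => ?_) h2
  have hq' : q.2 < q.1 := by simpa using List.of_mem_filter hq
  exact (hq'.trans_le h).ne

lemma mem_lowerList {q : Fin n × Fin n} : q ∈ lowerList n ↔ q.2 < q.1 := by
  simp [lowerList, List.mem_filter, List.product, List.mem_flatMap]

lemma nodup_lowerList : (lowerList n).Nodup :=
  ((List.nodup_finRange n).product (List.nodup_finRange n)).filter _

/-- In this order all products of distinct elementary terms vanish, so on `U` the product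
coordinates of `G` are the matrix entries. Restricting to the lower coordinates of `G` is therefore
restricting to `U`. -/
lemma coordG_extend (y : LowerIndex n → ℤ_[p]) :
    proPIwahori.toB (coordG (Function.extend Subtype.val y 0)) = lowerU.toB (lowerMk y) := by
  set x : Fin n × Fin n → ℤ_[p] := Function.extend Subtype.val y 0 with hx
  have hout : ∀ q : Fin n × Fin n, ¬ q.2 < q.1 → x q = 0 := fun q hq =>
    Function.extend_apply' _ _ _ fun ⟨j, hj⟩ => hq (hj ▸ j.2)
  have hone : ∀ L : List (Fin n × Fin n), (∀ q ∈ L, ¬ q.2 < q.1) →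
      (L.map fun q => oneParam q (x q)).prod = 1 := fun L hL => by
    refine List.prod_eq_one fun g hg => ?_
    obtain ⟨q, hq, rfl⟩ := List.mem_map.1 hg
    rw [hout q (hL q hq), oneParam_zero]
  have h1 : coordG x = ((lowerList n).map fun q => oneParam q (x q)).prod := by
    rw [coordG, orderedIndices, List.map_append, List.map_append, List.prod_append,
      List.prod_append, hone ((List.finRange n).map _), hone (List.reverse _), mul_one, mul_one]
    · intro q hq
      rw [List.mem_reverse, List.mem_filter] at hq
      have : q.1 < q.2 := by simpa using hq.2
      exact this.not_gt
    · intro q hq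
      obtain ⟨i, _, rfl⟩ := List.mem_map.1 hq
      exact lt_irrefl i
  have h2 : ((coordG x).1 : Matrix (Fin n) (Fin n) ℤ_[p]) =
      ((lowerList n).map fun q => 1 + Matrix.single q.1 q.2 (x q)).prod := by
    let F : proPIwahori p n →* Matrix (Fin n) (Fin n) ℤ_[p] :=
      (Units.coeHom _).comp (proPIwahori p n).subtype
    change F (coordG x) = _
    rw [h1, map_list_prod, List.map_map]
    congr 1
    refine List.map_congr_left fun q hq => ?_
    change oneParamMatrix q (x q) = _
    rw [oneParamMatrix, if_pos (mem_lowerList.1 hq)]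
  refine Subtype.ext (Units.ext ?_)
  change ((coordG x).1 : Matrix (Fin n) (Fin n) ℤ_[p]) = lowerMatrix y
  rw [h2, prod_one_add_single x _ pairwise_lowerList, ← List.sum_toFinset _ nodup_lowerList]
  ext i j
  rw [Matrix.add_apply, Matrix.sum_apply]
  simp only [Matrix.single_apply]
  have hsum : ∀ s : Finset (Fin n × Fin n),
      (∑ q ∈ s, if q.1 = i ∧ q.2 = j then x q else 0) = if (i, j) ∈ s then x (i, j) else 0 :=
    fun s => by
      rw [← Finset.sum_ite_eq' s (i, j) x]
      refine Finset.sum_congr rfl fun q _ => ?_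
      simp only [Prod.ext_iff]
  rw [hsum]
  simp only [List.mem_toFinset, mem_lowerList]
  rcases lt_trichotomy i j with h | rfl | h
  · rw [lowerMatrix_above _ h, Matrix.one_apply_ne h.ne, if_neg h.not_gt, add_zero]
  · rw [lowerMatrix_diag, Matrix.one_apply_eq, if_neg (lt_irrefl i), add_zero]
  · rw [lowerMatrix_below _ ⟨(i, j), h⟩, Matrix.one_apply_ne h.ne', if_pos h, zero_add, hx]
    exact Subtype.val_injective.extend_apply y 0 ⟨(i, j), h⟩

end Coordinates

/-! ### The representation on the globally analytic vectors -/

section Representation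

variable {p : ℕ} [Fact p.Prime] {n : ℕ} {K : Type*} [NormedField K] [NormedAlgebra ℚ_[p] K]
  [CompleteSpace K] [IsUltrametricDist K] {χ : Fin n → (ℤ_[p]ˣ →* Kˣ)}

variable (χ) in
lemma indFun_add (v w : AnalyticFunctionsU n K) :
    indFun χ (v + w) = indFun χ v + indFun χ w := by
  funext b
  simp [indFun, mul_add]

variable (χ) in
lemma indFun_smul (a : K) (v : AnalyticFunctionsU n K) :
    indFun χ (a • v) = a • indFun χ v := by
  funext b
  rw [indFun, map_smul, smul_eq_mul, mul_left_comm]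
  rfl

variable (χ) in
lemma indFun_lowerMk (v : AnalyticFunctionsU n K) (y : LowerIndex n → ℤ_[p]) :
    indFun χ v (lowerU.toB (lowerMk y)) = tateEval K y v :=
  (indFun_lower χ v (lowerMk y)).trans (by rw [coordU_lowerMk])

lemma indFun_injective : Function.Injective (indFun χ) := fun v w h =>
  tate_ext (p := p) fun y => by rw [← indFun_lowerMk χ, h, indFun_lowerMk]

lemma indFun_mem_ind (hχ : ∀ i, IsAnalyticOnOneUnits (χ i)) (v : AnalyticFunctionsU n K) :
    indFun χ v ∈ ind χ :=
  ⟨⟨indFun_isLocallyAnalyticOnB hχ v, indFun_equivariant χ v⟩, v, fun u => by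
    rw [hasValue_iff, indFun_lower]⟩

/-- Restriction to `U` is an isomorphism of the globally analytic vectors onto `𝒜(U, K)`. -/
noncomputable def indEquiv (hχ : ∀ i, IsAnalyticOnOneUnits (χ i)) :
    ind χ ≃ₗ[K] AnalyticFunctionsU n K :=
  (LinearEquiv.ofBijective
    ({ toFun := fun v => ⟨indFun χ v, indFun_mem_ind hχ v⟩
       map_add' := fun v w => Subtype.ext (indFun_add χ v w)
       map_smul' := fun a v => Subtype.ext (indFun_smul χ a v) } :
      AnalyticFunctionsU n K →ₗ[K] ind χ)
    ⟨fun v w h => indFun_injective (congrArg Subtype.val h), fun f => by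
      obtain ⟨⟨-, hf⟩, c, hc⟩ := f.2
      exact ⟨c, Subtype.ext (eq_indFun hf hc).symm⟩⟩).symm

lemma coe_indEquiv_symm (hχ : ∀ i, IsAnalyticOnOneUnits (χ i)) (v : AnalyticFunctionsU n K) :
    ((indEquiv hχ).symm v).1 = indFun χ v := rfl

lemma indFun_indEquiv (hχ : ∀ i, IsAnalyticOnOneUnits (χ i)) (f : ind χ) :
    indFun χ (indEquiv hχ f) = f.1 := by
  rw [← coe_indEquiv_symm hχ, LinearEquiv.symm_apply_apply]

lemma toB_mul (g h : proPIwahori p n) :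
    proPIwahori.toB (g * h) = proPIwahori.toB g * proPIwahori.toB h := rfl

lemma toB_inv (g : proPIwahori p n) : proPIwahori.toB g⁻¹ = (proPIwahori.toB g)⁻¹ := rfl

lemma toB_one : proPIwahori.toB (1 : proPIwahori p n) = 1 := rfl

/-- Left translates of globally analytic vectors are globally analytic. -/
lemma exists_indFun_eq_leftTranslate (hχ : ∀ i, IsAnalyticOnOneUnits (χ i))
    (h : proPIwahori p n) : ∃ C, ∀ v : AnalyticFunctionsU n K, ∃ w : AnalyticFunctionsU n K,
      ‖w‖ ≤ C * ‖v‖ ∧ indFun χ w = leftTranslate h (indFun χ v) := by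
  -- The family `y ↦ h⁻¹ u(y)`, along which `f_v` is the restriction to `U` of its translate.
  let M : analyticMatrices p K (LowerIndex n) n :=
    constMatrix h⁻¹ * lowerFamily fun q => tateCoord K q
  obtain ⟨C, hC⟩ := exists_isTate_indFun hχ M
  refine ⟨C, fun v => ?_⟩
  obtain ⟨c, hc, hv⟩ := hC v
  refine ⟨c, hc, (eq_indFun (fun g b => ?_) fun u => ?_).symm⟩
  · rw [leftTranslate, leftTranslate, ← mul_assoc, indFun_equivariant]
  · have h1 := hv (coordU u)
    have h2 : proPIwahori.toB (evalMatrix (coordU u) M) =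
        (proPIwahori.toB h)⁻¹ * lowerU.toB u := by
      rw [map_mul, evalMatrix_constMatrix, toB_mul, toB_evalMatrix_lowerFamily, toB_inv]
      change _ * lowerU.toB (lowerMk (coordU u)) = _
      rw [lowerMk_coordU]
    beta_reduce at h1
    rwa [h2] at h1

/-- The representation of `G` on `𝒜(U, K)` by left translation. -/
theorem exists_translation_rep (hχ : ∀ i, IsAnalyticOnOneUnits (χ i)) :
    ∃ π : proPIwahori p n →* (AnalyticFunctionsU n K →L[K] AnalyticFunctionsU n K),
      ∀ h v, indFun χ (π h v) = leftTranslate h (indFun χ v) := by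
  choose C T hT hT' using exists_indFun_eq_leftTranslate hχ
  let L : proPIwahori p n → AnalyticFunctionsU n K →L[K] AnalyticFunctionsU n K := fun h =>
    LinearMap.mkContinuous
      { toFun := T h
        map_add' := fun v w => indFun_injective (χ := χ) (by
          rw [indFun_add, hT', hT', hT', indFun_add]
          rfl)
        map_smul' := fun a v => indFun_injective (χ := χ) (by
          rw [RingHom.id_apply, indFun_smul, hT', hT', indFun_smul]
          rfl) } (C h) (hT h)
  have hL : ∀ h v, indFun χ (L h v) = leftTranslate h (indFun χ v) := hT'
  refine ⟨{ toFun := L, map_one' := ?_, map_mul' := fun g h => ?_ }, hL⟩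
  · refine ContinuousLinearMap.ext fun v => indFun_injective (χ := χ) ?_
    rw [hL]
    funext b
    rw [leftTranslate, toB_one, inv_one, one_mul]
    rfl
  · refine ContinuousLinearMap.ext fun v => indFun_injective (χ := χ) ?_
    rw [hL, mul_apply_eq_comp, hL, hL]
    funext b
    rw [leftTranslate, leftTranslate, leftTranslate, toB_mul, mul_inv_rev, mul_assoc]

variable {π : proPIwahori p n →* (AnalyticFunctionsU n K →L[K] AnalyticFunctionsU n K)}

/-- The function `f_v(g(x)⁻¹ u(y))` is jointly analytic in `(x, y)`; read as a function of `x` with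
values in functions of `y`, it is the orbit map. -/
theorem isGloballyAnalyticRep (hχ : ∀ i, IsAnalyticOnOneUnits (χ i))
    (hπ : ∀ h v, indFun χ (π h v) = leftTranslate h (indFun χ v)) :
    IsGloballyAnalyticRep π := by
  intro v
  let M : analyticMatrices p K ((Fin n × Fin n) ⊕ LowerIndex n) n :=
    (coordFamily fun q => tateCoord K (Sum.inl q))⁻¹ *
      lowerFamily fun q => tateCoord K (Sum.inr q)
  obtain ⟨C, hC⟩ := exists_isTate_indFun hχ M
  obtain ⟨c, -, hc⟩ := hC v
  refine exists_curry c (fun x => π (coordG x) v) fun x y => ?_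
  have h1 := hc (Sum.elim x y)
  have h2 : proPIwahori.toB (evalMatrix (Sum.elim x y) M) =
      (proPIwahori.toB (coordG x))⁻¹ * lowerU.toB (lowerMk y) := by
    rw [map_mul, map_inv, toB_mul, toB_inv, evalMatrix_coordFamily, toB_evalMatrix_lowerFamily]
    rfl
  beta_reduce at h1
  rw [h2] at h1
  rw [← indFun_lowerMk χ, hπ]
  exact h1

/-- Evaluation at `y = 0`, the identity of `U`, generates the dual: its matrix coefficient with `v`
is `f_v` on `G`, from which restriction to `U` recovers `v`. -/
theorem isAdmissibleRep (hχ : ∀ i, IsAnalyticOnOneUnits (χ i))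
    (hπ : ∀ h v, indFun χ (π h v) = leftTranslate h (indFun χ v)) : IsAdmissibleRep π := by
  refine ⟨isGloballyAnalyticRep hχ hπ, 1, fun _ => tateEval K (0 : LowerIndex n → ℤ_[p]),
    fun l' => ⟨fun _ => l'.comp (tateRestrict fun q : Fin n × Fin n => q.2 < q.1), fun v => ?_⟩⟩
  obtain ⟨C, hC⟩ := exists_isTate_indFun hχ
    (coordFamily fun q => tateCoord K q : analyticMatrices p K (Fin n × Fin n) n)
  obtain ⟨F, -, hF⟩ := hC v
  have hF' : ∀ x, HasValue p K F x (indFun χ v (proPIwahori.toB (coordG x))) := fun x => by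
    have h := hF x
    beta_reduce at h
    rwa [evalMatrix_coordFamily] at h
  refine ⟨fun _ => F, fun _ x => ?_, ?_⟩
  · have h1 : lowerU.toB (lowerMk (0 : LowerIndex n → ℤ_[p])) = 1 := by
      have h0 := lowerMk_coordU (1 : lowerU p n)
      have h2 : coordU (1 : lowerU p n) = 0 := funext fun q => Matrix.one_apply_ne q.2.ne'
      rw [h2] at h0
      rw [h0]
      rfl
    rw [← indFun_lowerMk χ, hπ, h1, leftTranslate, toB_inv, inv_inv, mul_one]
    exact hF' x
  · have h1 : tateRestrict (fun q : Fin n × Fin n => q.2 < q.1) F = v := by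
      refine tate_ext (p := p) fun y => ?_
      refine hasValue_iff.1 (HasValue.tateRestrict ?_)
      rw [← indFun_lowerMk χ, ← coordG_extend]
      exact hF' _
    simp [h1]

/-- The main theorem for characters that are analytic on `1 + p ℤ_p`. -/
theorem exists_analytic_rep (hχ : ∀ i, IsAnalyticOnOneUnits (χ i)) :
    ∃ Φ : ind χ ≃ₗ[K] AnalyticFunctionsU n K,
      (∀ f : ind χ, IsExpansionOnU (Φ f) f.1) ∧
      ∃ π : proPIwahori p n →* (AnalyticFunctionsU n K →L[K] AnalyticFunctionsU n K),
        (∀ (h : proPIwahori p n) (f : ind χ),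
          (Φ.symm (π h (Φ f))).1 = leftTranslate h f.1) ∧
        IsGloballyAnalyticRep π ∧ IsAdmissibleRep π := by
  obtain ⟨π, hπ⟩ := exists_translation_rep hχ
  refine ⟨indEquiv hχ, fun f u => ?_, π, fun h f => ?_, isGloballyAnalyticRep hχ hπ,
    isAdmissibleRep hχ hπ⟩
  · rw [hasValue_iff, ← indFun_lower χ, indFun_indEquiv]
  · rw [coe_indEquiv_symm, hπ, indFun_indEquiv]

end Representation

/-! ### The binomial series -/

section Binomial

variable {p : ℕ} [Fact p.Prime] {K : Type*} [NormedField K] [NormedAlgebra ℚ_[p] K]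

variable (p) in
lemma norm_natCast_eq (m : ℕ) : ‖(m : K)‖ = ‖(m : ℚ_[p])‖ := by
  rw [← map_natCast (algebraMap ℚ_[p] K), norm_algebraMap']

variable (p) in
-- Legendre's formula: `(p - 1) v_p(k!)` is `k` minus the digit sum of `k`. The power `p - 1` avoids
-- fractional exponents.
lemma norm_factorial_inv_pow_le (k : ℕ) :
    (‖(k.factorial : K)‖⁻¹) ^ (p - 1) ≤ (p : ℝ) ^ k := by
  have hp1 : (1 : ℝ) ≤ p := by exact_mod_cast (Fact.out : p.Prime).one_lt.le
  have h0 : (k.factorial : ℚ_[p]) ≠ 0 := by exact_mod_cast k.factorial_ne_zero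
  rw [norm_natCast_eq p, Padic.norm_eq_zpow_neg_valuation h0, Padic.valuation_natCast, zpow_neg,
    inv_inv, zpow_natCast, ← pow_mul]
  refine pow_le_pow_right₀ hp1 ?_
  rw [mul_comm, sub_one_mul_padicValNat_factorial]
  exact Nat.sub_le _ _

lemma tendsto_zero_of_pow {x : ℕ → ℝ} (hx : ∀ k, 0 ≤ x k) (N : ℕ)
    (h : Tendsto (fun k => x k ^ N) atTop (𝓝 0)) : Tendsto x atTop (𝓝 0) := by
  rw [Metric.tendsto_nhds] at h ⊢
  intro ε hε
  filter_upwards [h (ε ^ N) (pow_pos hε N)] with k hk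
  rw [dist_zero_right, Real.norm_of_nonneg (pow_nonneg (hx k) N)] at hk
  rw [dist_zero_right, Real.norm_of_nonneg (hx k)]
  exact lt_of_pow_lt_pow_left₀ N hε.le hk

variable (p) in
/-- The coefficients of `u ↦ (1 + p u) ^ c`. -/
noncomputable def binomialCoeff (c : K) (k : ℕ) : K :=
  (∏ j ∈ Finset.range k, (c - j)) / k.factorial * (p : K) ^ k

/-- With `M = max(‖c‖, 1)`, the `(p - 1)`-st power of the `k`-th norm is at most `r^k` for `r = (M /
p)^(p - 1) p`, and `r < 1` means `M^(p - 1) < p^(p - 2)`. The case `M = 1` is where `p > 2` enters.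
-/
lemma tendsto_binomialCoeff (hp : 2 < p) {c : K} (hc : ‖c‖ ^ (p - 1) < (p : ℝ) ^ (p - 2))
    [IsUltrametricDist K] : Tendsto (binomialCoeff p c) atTop (𝓝 0) := by
  obtain ⟨N, rfl⟩ : ∃ N, p = N + 2 := ⟨p - 2, by omega⟩
  set p := N + 2 with hpN
  have hp0 : (0 : ℝ) < p := by exact_mod_cast (by omega : 0 < p)
  have hp1 : (1 : ℝ) < p := by exact_mod_cast (by omega : 1 < p)
  let M := max ‖c‖ 1
  have hM : 0 ≤ M := (norm_nonneg c).trans (le_max_left _ _)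
  let r : ℝ := M ^ (p - 1) * (p : ℝ)⁻¹ ^ (p - 1) * p
  have hM' : M ^ (p - 1) < (p : ℝ) ^ (p - 2) := by
    rcases max_choice ‖c‖ 1 with h | h
    · simpa only [M, h] using hc
    · simp only [M, h, one_pow]
      exact one_lt_pow₀ hp1 (by omega)
  have hr0 : 0 ≤ r := by positivity
  have hr : r < 1 := by
    have h1 : r < (p : ℝ) ^ (p - 2) * (p : ℝ)⁻¹ ^ (p - 1) * p := by
      simp only [r]
      gcongr
    refine h1.trans_eq ?_
    have h2 : p - 1 = (p - 2) + 1 := by omega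
    rw [h2, pow_succ, ← mul_assoc, ← mul_pow, mul_inv_cancel₀ hp0.ne', one_pow, one_mul,
      inv_mul_cancel₀ hp0.ne']
  rw [tendsto_zero_iff_norm_tendsto_zero]
  refine tendsto_zero_of_pow (fun k => norm_nonneg _) (p - 1) (squeeze_zero (fun k => by positivity)
    (fun k => ?_) (tendsto_pow_atTop_nhds_zero_of_lt_one hr0 hr))
  have h1 : ‖∏ j ∈ Finset.range k, (c - (j : K))‖ ≤ M ^ k := by
    rw [norm_prod]
    refine (Finset.prod_le_prod (fun _ _ => norm_nonneg _) fun j _ => ?_).trans_eq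
      (by rw [Finset.prod_const, Finset.card_range] : ∏ _j ∈ Finset.range k, M = M ^ k)
    rw [sub_eq_add_neg]
    refine (IsUltrametricDist.norm_add_le_max c (-j)).trans (max_le_max le_rfl ?_)
    rw [norm_neg, norm_natCast_eq p]
    exact IsUltrametricDist.norm_natCast_le_one ℚ_[p] j
  have h2 : ‖(p : K)‖ = (p : ℝ)⁻¹ := by rw [norm_natCast_eq p, Padic.norm_p]
  have h3 : ‖binomialCoeff p c k‖ ^ (p - 1) =
      ‖∏ j ∈ Finset.range k, (c - (j : K))‖ ^ (p - 1) * (‖(k.factorial : K)‖⁻¹) ^ (p - 1) *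
        ((p : ℝ)⁻¹ ^ k) ^ (p - 1) := by
    rw [binomialCoeff, norm_mul, norm_div, norm_pow, h2, div_eq_mul_inv, mul_pow, mul_pow]
  rw [h3]
  calc _ ≤ (M ^ k) ^ (p - 1) * (p : ℝ) ^ k * ((p : ℝ)⁻¹ ^ k) ^ (p - 1) := by
        gcongr
        exact norm_factorial_inv_pow_le p k
    _ = r ^ k := by
        simp only [r, mul_pow, ← pow_mul, mul_comm k]
        ring

end Binomial

/-! ### Extension of local expansions of characters of `1 + p ℤ_p` -/

section OneVariable

variable {p : ℕ} [Fact p.Prime] {K : Type*} [NormedField K] [NormedAlgebra ℚ_[p] K]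
  [CompleteSpace K] [IsUltrametricDist K]

/-- The unit `1 + p u`. -/
noncomputable def oneUnit (u : ℤ_[p]) : ℤ_[p]ˣ := (isUnit_one_add_prime_mul u).unit

lemma coe_oneUnit (u : ℤ_[p]) : (oneUnit u : ℤ_[p]) = 1 + p * u := rfl

lemma oneUnit_mul (u v : ℤ_[p]) : oneUnit u * oneUnit v = oneUnit (u + v + (p : ℤ_[p]) * (u * v)) := by
  refine Units.ext ?_
  rw [Units.val_mul, coe_oneUnit, coe_oneUnit, coe_oneUnit]
  ring

/-- A power series on `ℤ_p` that agrees with `u ↦ θ(1 + p u)` near `0` is multiplicative on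
`1 + p ℤ_p`. -/
lemma powerSeries_mul {θ : ℤ_[p]ˣ →* Kˣ} {a : ℕ → K} (ha : Tendsto a atTop (𝓝 0))
    {g : ℤ_[p] → K} (hg : ∀ u, HasSum (fun m => a m * padicEmb p K u ^ m) (g u))
    (h : ∀ᶠ u in 𝓝 0, (θ (oneUnit u) : K) = g u) (u v : ℤ_[p]) :
    g (u + v + (p : ℤ_[p]) * (u * v)) = g u * g v := by
  let X : tateRing p K (Fin 2) := tateCoord K 0
  let Y : tateRing p K (Fin 2) := tateCoord K 1
  obtain ⟨D₁, h₁⟩ := exists_isTate_powerSeries ha hg X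
  obtain ⟨D₂, h₂⟩ := exists_isTate_powerSeries ha hg Y
  obtain ⟨D₃, h₃⟩ := exists_isTate_powerSeries ha hg (X + Y + (p : tateRing p K (Fin 2)) * (X * Y))
  obtain ⟨c, -, hc⟩ := (h₃.mono (le_max_left _ _)).add
    (((h₁.mul h₂).const_mul (-1)).mono (le_max_right D₃ _))
  have hv : ∀ x : Fin 2 → ℤ_[p], HasValue p K c x
      (g (x 0 + x 1 + (p : ℤ_[p]) * (x 0 * x 1)) + -1 * (g (x 0) * g (x 1))) := hc
  -- The series `c` represents the defect of multiplicativity in two variables. It vanishes near the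
  -- origin, where `g` is the character, hence identically.
  have h0 : c = 0 := by
    refine tate_eq_zero_of_eventually (p := p) c ?_
    have hev : ∀ i, ∀ᶠ x : Fin 2 → ℤ_[p] in 𝓝 0, (θ (oneUnit (x i)) : K) = g (x i) := fun i =>
      have hcont : Continuous fun x : Fin 2 → ℤ_[p] => x i := continuous_apply i
      (hcont.tendsto 0).eventually h
    have e2 : ∀ᶠ x : Fin 2 → ℤ_[p] in 𝓝 0, (θ (oneUnit (x 0 + x 1 + (p : ℤ_[p]) * (x 0 * x 1))) : K) =
        g (x 0 + x 1 + (p : ℤ_[p]) * (x 0 * x 1)) := by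
      have hcont : Continuous fun x : Fin 2 → ℤ_[p] => x 0 + x 1 + (p : ℤ_[p]) * (x 0 * x 1) := by fun_prop
      have ht := hcont.tendsto 0
      simp only [Pi.zero_apply, add_zero, mul_zero] at ht
      exact ht.eventually h
    filter_upwards [hev 0, hev 1, e2] with x h0 h1 h2
    have h3 := hv x
    rwa [← h0, ← h1, ← h2, ← oneUnit_mul, map_mul, Units.val_mul, neg_one_mul,
      add_neg_cancel] at h3
  have h1 := (hasValue_iff.1 (hv ![u, v])).symm
  rw [h0, map_zero] at h1
  simp only [Matrix.cons_val_zero, Matrix.cons_val_one, neg_one_mul] at h1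
  exact add_neg_eq_zero.1 h1

/-- If `K` contains no primitive `p`-th root of unity, then a power series on `ℤ_p` that agrees
with `u ↦ θ(1 + p u)` near `0` agrees with it everywhere. -/
lemma eq_powerSeries_of_eventually {θ : ℤ_[p]ˣ →* Kˣ} {a : ℕ → K} (ha : Tendsto a atTop (𝓝 0))
    {g : ℤ_[p] → K} (hg : ∀ u, HasSum (fun m => a m * padicEmb p K u ^ m) (g u))
    (h : ∀ᶠ u in 𝓝 0, (θ (oneUnit u) : K) = g u) (hroot : ¬ ∃ ζ : K, IsPrimitiveRoot ζ p)
    (u : ℤ_[p]) : (θ (oneUnit u) : K) = g u := by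
  have hp : p.Prime := Fact.out
  have h1 : g 0 = 1 := by
    have h2 := h.self_of_nhds
    have h3 : oneUnit (0 : ℤ_[p]) = 1 := Units.ext (by simp [coe_oneUnit])
    rw [← h2, h3, map_one, Units.val_one]
  have hpow : ∀ k : ℕ, ∃ w, oneUnit u ^ k = oneUnit w ∧ g u ^ k = g w := by
    intro k
    induction k with
    | zero => exact ⟨0, Units.ext (by simp [coe_oneUnit]), by rw [pow_zero, h1]⟩
    | succ k ih =>
      obtain ⟨w, hw, hw'⟩ := ih
      exact ⟨w + u + (p : ℤ_[p]) * (w * u), by rw [pow_succ, hw, oneUnit_mul],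
        by rw [pow_succ, hw', powerSeries_mul ha hg h]⟩
  have hlim : ∃ N : ℕ, ∀ w : ℤ_[p], (p : ℤ_[p]) ^ N ∣ w → (θ (oneUnit w) : K) = g w := by
    obtain ⟨ε, hε, hball⟩ := Metric.eventually_nhds_iff.1 h
    obtain ⟨N, hN⟩ := exists_pow_lt_of_lt_one hε (norm_prime_lt_one (p := p))
    refine ⟨N, fun w ⟨z, hz⟩ => hball ?_⟩
    rw [dist_zero_right, hz, norm_mul, norm_pow]
    exact (mul_le_of_le_one_right (by positivity) (PadicInt.norm_le_one z)).trans_lt hN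
  obtain ⟨N, hN⟩ := hlim
  obtain ⟨w, hw, hw'⟩ := hpow (p ^ N)
  -- Raising to the power `p^N` moves `1 + p ℤ_p` into `1 + p^(N+1) ℤ_p`; one factor `p` is absorbed
  -- by the parametrization `1 + p w`.
  have hdvd : (p : ℤ_[p]) ^ N ∣ w := by
    have h2 : (p : ℤ_[p]) ∣ (oneUnit u : ℤ_[p]) - 1 := by
      rw [coe_oneUnit, add_sub_cancel_left]
      exact dvd_mul_right _ _
    have h3 := dvd_sub_pow_of_dvd_sub h2 N
    rw [one_pow, ← Units.val_pow_eq_pow_val, hw, coe_oneUnit, add_sub_cancel_left, pow_succ'] at h3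
    exact (mul_dvd_mul_iff_left (by exact_mod_cast hp.ne_zero)).1 h3
  have heq : (θ (oneUnit u) : K) ^ p ^ N = g u ^ p ^ N := by
    rw [hw', ← hN w hdvd, ← hw, map_pow, Units.val_pow_eq_pow_val]
  have hg0 : g u ≠ 0 := by
    intro h0
    rw [h0, zero_pow (pow_pos hp.pos N).ne'] at heq
    exact (θ (oneUnit u)).ne_zero (pow_eq_zero_iff (pow_pos hp.pos N).ne' |>.1 heq)
  by_contra hne
  -- The quotient has `p`-power order; were it not `1`, a suitable power of it would be a primitive
  -- `p`-th root of unity.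
  have hζ : ((θ (oneUnit u) : K) / g u) ^ p ^ N = 1 := by
    rw [div_pow, heq, div_self (pow_ne_zero _ hg0)]
  have hζ1 : (θ (oneUnit u) : K) / g u ≠ 1 := fun h2 => hne ((div_eq_one_iff_eq hg0).1 h2)
  obtain ⟨k, -, hk⟩ := (Nat.dvd_prime_pow hp).1 (orderOf_dvd_of_pow_eq_one hζ)
  have hk0 : k ≠ 0 := fun h2 => hζ1 (orderOf_eq_one_iff.1 (by rw [hk, h2, pow_zero]))
  refine hroot ⟨_, (IsPrimitiveRoot.orderOf ((θ (oneUnit u) : K) / g u)).pow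
    (a := p ^ (k - 1)) (by rw [hk]; exact pow_pos hp.pos k) ?_⟩
  rw [hk, ← pow_succ, Nat.sub_add_cancel (Nat.pos_of_ne_zero hk0)]

end OneVariable

/-! ### Locally analytic characters near `1` -/

section LocallyAnalytic

variable {p : ℕ} [Fact p.Prime] {K : Type*} [NormedField K] [NormedAlgebra ℚ_[p] K]

lemma eventually_exists_unit (t : ℤ_[p]ˣ) :
    ∀ᶠ x : ℚ_[p] in 𝓝 ((t : ℤ_[p]) : ℚ_[p]), ∃ s : ℤ_[p]ˣ, ((s : ℤ_[p]) : ℚ_[p]) = x := by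
  have ht : ‖((t : ℤ_[p]) : ℚ_[p])‖ = 1 := by
    rw [← PadicInt.norm_def]
    exact PadicInt.isUnit_iff.1 t.isUnit
  have hball : ∀ᶠ x : ℚ_[p] in 𝓝 ((t : ℤ_[p]) : ℚ_[p]), x ∈ Metric.ball ((t : ℤ_[p]) : ℚ_[p]) 1 :=
    Metric.ball_mem_nhds _ one_pos
  filter_upwards [hball] with x hx
  rw [mem_ball_iff_norm] at hx
  have hx1 : ‖x‖ = 1 := by
    have h := IsUltrametricDist.norm_add_eq_max_of_norm_ne_norm (x := x - ((t : ℤ_[p]) : ℚ_[p]))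
      (y := ((t : ℤ_[p]) : ℚ_[p])) (by rw [ht]; exact hx.ne)
    rwa [sub_add_cancel, ht, max_eq_right hx.le] at h
  let y : ℤ_[p] := ⟨x, hx1.le⟩
  have hy : IsUnit y := PadicInt.isUnit_iff.2 (by rw [PadicInt.norm_def]; exact hx1)
  exact ⟨hy.unit, rfl⟩

lemma coe_unit_ne_zero (t : ℤ_[p]ˣ) : ((t : ℤ_[p]) : ℚ_[p]) ≠ 0 := fun h =>
  t.ne_zero (Subtype.ext h)

/-- The differential equation of a locally analytic character. -/
lemma hasDerivAt_character {θ : ℤ_[p]ˣ →* Kˣ} {c : K} {F : ℚ_[p] → K}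
    (hF : ∀ t : ℤ_[p]ˣ, F ((t : ℤ_[p]) : ℚ_[p]) = θ t) (hF1 : HasDerivAt F c 1) (t : ℤ_[p]ˣ) :
    HasDerivAt F (c * (algebraMap ℚ_[p] K ((t : ℤ_[p]) : ℚ_[p]))⁻¹ * F ((t : ℤ_[p]) : ℚ_[p]))
      ((t : ℤ_[p]) : ℚ_[p]) := by
  set τ : ℚ_[p] := ((t : ℤ_[p]) : ℚ_[p]) with hτ
  have hτ0 : τ ≠ 0 := coe_unit_ne_zero t
  -- Multiplicativity gives `F(x) = F(τ) F(τ⁻¹ x)` near `τ`, which carries the derivative at `1` to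
  -- `τ`.
  have h1 : HasDerivAt (fun x => F τ * F (τ⁻¹ * x)) (F τ * (τ⁻¹ • c)) τ := by
    have h2 : HasDerivAt (fun x : ℚ_[p] => τ⁻¹ * x) τ⁻¹ τ := by
      simpa using (hasDerivAt_id τ).const_mul τ⁻¹
    have h3 : HasDerivAt F c (τ⁻¹ * τ) := by rwa [inv_mul_cancel₀ hτ0]
    exact (h3.scomp τ h2).const_mul (F τ)
  have h4 : F τ * (τ⁻¹ • c) = c * (algebraMap ℚ_[p] K τ)⁻¹ * F τ := by
    rw [Algebra.smul_def, map_inv₀]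
    ring
  rw [h4] at h1
  refine h1.congr_of_eventuallyEq ?_
  filter_upwards [eventually_exists_unit t] with x ⟨s, hs⟩
  have h5 : τ⁻¹ * x = (((t⁻¹ * s : ℤ_[p]ˣ) : ℤ_[p]) : ℚ_[p]) := by
    rw [inv_mul_eq_iff_eq_mul₀ hτ0, ← hs, hτ, ← PadicInt.coe_mul, ← Units.val_mul,
      mul_inv_cancel_left]
  rw [h5, ← hs, hF, hτ, hF, hF, ← Units.val_mul, ← map_mul, mul_inv_cancel_left]

/-- Each differentiation of `x^(-k) F` yields a factor `(c - k) x⁻¹`. The formula is needed near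
every unit, not just at `1`, so that it can be differentiated again. -/
lemma iteratedDeriv_character {θ : ℤ_[p]ˣ →* Kˣ} {c : K} {F : ℚ_[p] → K}
    (hF : ∀ t : ℤ_[p]ˣ, F ((t : ℤ_[p]) : ℚ_[p]) = θ t) (hF1 : HasDerivAt F c 1) (k : ℕ)
    (t : ℤ_[p]ˣ) :
    iteratedDeriv k F =ᶠ[𝓝 ((t : ℤ_[p]) : ℚ_[p])] fun x =>
      (∏ j ∈ Finset.range k, (c - j)) * (x⁻¹ ^ k • F x) := by
  induction k generalizing t with
  | zero => simp
  | succ k ih =>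
    filter_upwards [eventually_exists_unit t] with x ⟨s, hs⟩
    rw [iteratedDeriv_succ, ← hs, (ih s).deriv_eq]
    set σ : ℚ_[p] := ((s : ℤ_[p]) : ℚ_[p]) with hσ
    have hσ0 : algebraMap ℚ_[p] K σ ≠ 0 := by
      rw [Ne, map_eq_zero]
      exact coe_unit_ne_zero s
    have h1 := (hasDerivAt_inv (coe_unit_ne_zero s)).fun_pow k
    have h2 := (h1.fun_smul (hasDerivAt_character hF hF1 s)).const_mul
      (∏ j ∈ Finset.range k, (c - (j : K)))
    refine h2.deriv.trans ?_
    rw [Finset.prod_range_succ, mul_assoc _ (c - (k : K))]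
    congr 1
    simp only [← hσ, Algebra.smul_def, map_mul, map_pow, map_inv₀, map_neg, map_natCast]
    rcases k with _ | k
    · simp
      ring
    · simp only [Nat.add_sub_cancel, inv_pow]
      field_simp
      push_cast
      ring

/-- The Taylor expansion of a locally analytic character at `1`. -/
lemma eventually_hasSum_character [CompleteSpace K] {θ : ℤ_[p]ˣ →* Kˣ} {c : K} {F : ℚ_[p] → K}
    (hFa : AnalyticAt ℚ_[p] F 1) (hF : ∀ t : ℤ_[p]ˣ, F ((t : ℤ_[p]) : ℚ_[p]) = θ t)
    (hF1 : HasDerivAt F c 1) :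
    ∀ᶠ u : ℤ_[p] in 𝓝 0,
      HasSum (fun m => binomialCoeff p c m * padicEmb p K u ^ m) (θ (oneUnit u) : K) := by
  obtain ⟨q, hq⟩ := hFa
  have hcoeff : ∀ k, q.coeff k = (∏ j ∈ Finset.range k, (c - (j : K))) / k.factorial := by
    intro k
    obtain ⟨r, hr⟩ := hq
    have h1 := hr.factorial_smul 1 k
    rw [← iteratedDeriv_eq_iteratedFDeriv] at h1
    have h2 := (iteratedDeriv_character hF hF1 k 1).self_of_nhds
    have h3 : (((1 : ℤ_[p]ˣ) : ℤ_[p]) : ℚ_[p]) = 1 := rfl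
    have h4 : F 1 = 1 := by
      rw [← h3, hF, map_one, Units.val_one]
    beta_reduce at h2
    rw [h3, inv_one, one_pow, one_smul, h4, mul_one] at h2
    have h5 : (k.factorial : K) ≠ 0 := by
      rw [← map_natCast (algebraMap ℚ_[p] K), Ne, map_eq_zero]
      exact_mod_cast k.factorial_ne_zero
    rw [eq_div_iff h5, ← h2, ← h1, nsmul_eq_mul, mul_comm]
    rfl
  rw [hasFPowerSeriesAt_iff] at hq
  have hcont : Tendsto (fun u : ℤ_[p] => ((p * u : ℤ_[p]) : ℚ_[p])) (𝓝 0) (𝓝 0) := by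
    have : Continuous fun u : ℤ_[p] => (((p : ℤ_[p]) * u : ℤ_[p]) : ℚ_[p]) :=
      PadicInt.isOpenEmbedding_coe.continuous.comp (continuous_const.mul continuous_id)
    simpa using this.tendsto 0
  filter_upwards [hcont.eventually hq] with u hu
  have h1 : (1 : ℚ_[p]) + ((p * u : ℤ_[p]) : ℚ_[p]) = ((oneUnit u : ℤ_[p]) : ℚ_[p]) := by
    rw [coe_oneUnit]
    simp
  rw [h1, hF] at hu
  refine hu.congr_fun fun m => ?_
  rw [hcoeff, binomialCoeff, Algebra.smul_def, map_pow, ← padicEmb_apply, map_mul, map_natCast,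
    mul_pow]
  ring

/-- Without a primitive `p`-th root of unity in `K`, a locally analytic character whose derivative
is not too large is analytic on `1 + p ℤ_p`. -/
theorem isAnalyticOnOneUnits [CompleteSpace K] [IsUltrametricDist K] (hp : 2 < p)
    {θ : ℤ_[p]ˣ →* Kˣ} {c : K} (hθ : IsLocallyAnalyticChar θ c)
    (hc : ‖c‖ ^ (p - 1) < (p : ℝ) ^ (p - 2)) (hroot : ¬ ∃ ζ : K, IsPrimitiveRoot ζ p) :
    IsAnalyticOnOneUnits θ := by
  obtain ⟨F, hF, hF1⟩ := hθ
  have ha := tendsto_binomialCoeff hp hc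
  have hev := eventually_hasSum_character (by simpa using (hF 1).1) (fun t => (hF t).2) hF1
  refine ⟨binomialCoeff p c, ha, fun u t ht => ?_⟩
  have hg := hasSum_padic_powerSeries ha (p := p)
  have h1 := eq_powerSeries_of_eventually ha hg
    (hev.mono fun u hu => hu.unique (hg u)) hroot u
  have h2 : t = oneUnit u := Units.ext ht
  rw [h2, h1]
  exact hg u

end LocallyAnalytic

/-! ### The ramification index -/

section Ramification

variable {p : ℕ} [Fact p.Prime] {K : Type*} [NormedField K] [NormedAlgebra ℚ_[p] K]

lemma isUltrametricDist_of_padic (p : ℕ) [Fact p.Prime] (K : Type*) [NormedField K]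
    [NormedAlgebra ℚ_[p] K] : IsUltrametricDist K :=
  IsUltrametricDist.isUltrametricDist_of_forall_norm_natCast_le_one fun m => by
    rw [norm_natCast_eq p]
    exact IsUltrametricDist.norm_natCast_le_one ℚ_[p] m

lemma mem_valueGroup {F : Type*} [NormedField F] {r : ℝˣ} :
    r ∈ valueGroup F ↔ ∃ x : Fˣ, ‖(x : F)‖ = r := by
  constructor
  · rintro ⟨x, rfl⟩
    exact ⟨x, rfl⟩
  · rintro ⟨x, hx⟩
    exact ⟨x, Units.ext hx⟩

variable (p K) in
-- A relative index is `0` by convention when infinite, so finiteness is the point. The norm is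
-- locally constant on the compact annulus `1 ≤ ‖x‖ ≤ p`, hence takes finitely many values there,
-- and powers of `p` move every value into that range.
lemma ramificationIndex_ne_zero [FiniteDimensional ℚ_[p] K] : ramificationIndex p K ≠ 0 := by
  have := isUltrametricDist_of_padic p K
  have : ProperSpace K := FiniteDimensional.proper ℚ_[p] K
  have hp1 : (1 : ℝ) < p := by exact_mod_cast (Fact.out : p.Prime).one_lt
  have hp0 : (0 : ℝ) < p := one_pos.trans hp1
  let S : Set K := {x | 1 ≤ ‖x‖ ∧ ‖x‖ ≤ p}
  have hS : IsCompact S := by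
    refine Metric.isCompact_of_isClosed_isBounded ?_ ?_
    · exact (isClosed_le continuous_const continuous_norm).inter
        (isClosed_le continuous_norm continuous_const)
    · exact (Metric.isBounded_closedBall (x := (0 : K)) (r := p)).subset fun x hx => by
        simpa using hx.2
  have : CompactSpace S := isCompact_iff_compactSpace.1 hS
  have hloc : IsLocallyConstant fun x : S => ‖(x : K)‖ := by
    rw [IsLocallyConstant.iff_eventually_eq]
    intro x
    have hball : ∀ᶠ y : S in 𝓝 x, y ∈ Metric.ball x 1 := Metric.ball_mem_nhds x one_pos
    filter_upwards [hball] with y hy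
    have hy' : ‖(y : K) - x‖ < ‖(x : K)‖ := by
      rw [Metric.mem_ball, Subtype.dist_eq, dist_eq_norm] at hy
      exact hy.trans_le x.2.1
    have h := IsUltrametricDist.norm_add_eq_max_of_norm_ne_norm hy'.ne
    rwa [sub_add_cancel, max_eq_right hy'.le] at h
  have hfin : (Set.range fun x : S => ‖(x : K)‖).Finite := hloc.range_finite
  have hfin' : {v : valueGroup K | 1 ≤ (v.1 : ℝ) ∧ (v.1 : ℝ) ≤ p}.Finite := by
    refine (hfin.preimage (f := fun v : valueGroup K => (v.1 : ℝ)) ?_).subset fun v hv => ?_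
    · exact fun v _ w _ h => Subtype.ext (Units.ext h)
    · obtain ⟨x, hx⟩ := mem_valueGroup.1 v.2
      exact ⟨⟨x, by rw [Set.mem_ofPred_eq, hx]; exact hv⟩, hx⟩
  have hpQ : ∀ m : ℤ, (Units.mk0 (p : ℝ) hp0.ne') ^ m ∈ valueGroup ℚ_[p] := fun m => by
    refine zpow_mem (mem_valueGroup.2 ?_) m
    have hp' : (p : ℚ_[p]) ≠ 0 := by exact_mod_cast (Fact.out : p.Prime).ne_zero
    exact ⟨(Units.mk0 _ hp')⁻¹, by simp⟩
  have hle : valueGroup ℚ_[p] ≤ valueGroup K := fun v hv => by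
    obtain ⟨x, hx⟩ := mem_valueGroup.1 hv
    exact mem_valueGroup.2 ⟨Units.map (algebraMap ℚ_[p] K).toMonoidHom x, by simpa using hx⟩
  have := hfin'.to_subtype
  have : Finite (valueGroup K ⧸ (valueGroup ℚ_[p]).subgroupOf (valueGroup K)) := by
    refine Finite.of_surjective (α := {v : valueGroup K | 1 ≤ (v.1 : ℝ) ∧ (v.1 : ℝ) ≤ p})
      (fun v => (v.1 : valueGroup K ⧸ (valueGroup ℚ_[p]).subgroupOf (valueGroup K))) fun q => ?_
    obtain ⟨v, rfl⟩ := QuotientGroup.mk_surjective q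
    obtain ⟨x, hx⟩ := mem_valueGroup.1 v.2
    have hv0 : (0 : ℝ) < v.1 := by
      rw [← hx]
      exact norm_pos_iff.2 x.ne_zero
    obtain ⟨m, hm1, hm2⟩ := exists_mem_Ico_zpow hv0 hp1
    let s : valueGroup K := ⟨_, hle (hpQ (-m))⟩
    have hs : (s.1 : ℝ) = (p : ℝ) ^ (-m) := by simp [s]
    refine ⟨⟨v * s, ?_, ?_⟩, ?_⟩
    · rw [Subgroup.coe_mul, Units.val_mul, hs, zpow_neg, ← div_eq_mul_inv,
        one_le_div (zpow_pos hp0 m)]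
      exact hm1
    · rw [Subgroup.coe_mul, Units.val_mul, hs, zpow_neg, ← div_eq_mul_inv,
        div_le_iff₀ (zpow_pos hp0 m), mul_comm, ← zpow_add_one₀ hp0.ne']
      exact hm2.le
    · rw [QuotientGroup.eq, Subgroup.mem_subgroupOf]
      have : (v * s)⁻¹ * v = s⁻¹ := by rw [mul_inv_rev, inv_mul_cancel_right]
      rw [this]
      exact inv_mem (hpQ (-m))
  exact Subgroup.index_ne_zero_of_finite

/-- From `e ≥ 1` one gets `v_p(c) > 1 / (p - 1) - 1`; multiplying by `p - 1` makes the bound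
integral. -/
lemma norm_pow_lt_of_ltValuation [FiniteDimensional ℚ_[p] K] (hp : 2 < p) {c : K}
    (hc : LtValuation p ((ramificationIndex p K : ℝ) / ((p : ℝ) - 1) - 1) c) :
    ‖c‖ ^ (p - 1) < (p : ℝ) ^ (p - 2) := by
  have hp1 : (1 : ℝ) < p := by exact_mod_cast (by omega : 1 < p)
  have he : (1 : ℝ) ≤ ramificationIndex p K := by
    exact_mod_cast Nat.one_le_iff_ne_zero.2 (ramificationIndex_ne_zero p K)
  by_cases h0 : c = 0
  · rw [h0, norm_zero, zero_pow (by omega)]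
    positivity
  · have h1 := hc.resolve_left h0
    have hpos : 0 < ‖c‖ := norm_pos_iff.2 h0
    have h2 : ((p : ℝ) - 1) * Real.logb p ‖c‖ < p - 2 := by
      have h3 : 1 / ((p : ℝ) - 1) ≤ (ramificationIndex p K : ℝ) / ((p : ℝ) - 1) :=
        div_le_div_of_nonneg_right he (by linarith)
      have h4 : Real.logb p ‖c‖ < 1 - 1 / ((p : ℝ) - 1) := by linarith
      have h5 : ((p : ℝ) - 1) * (1 - 1 / ((p : ℝ) - 1)) = p - 2 := by
        have : (p : ℝ) - 1 ≠ 0 := by linarith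
        field_simp
        ring
      rw [← h5]
      exact mul_lt_mul_of_pos_left h4 (by linarith)
    have h6 : Real.logb p (‖c‖ ^ (p - 1)) < ((p - 2 : ℕ) : ℝ) := by
      rw [Real.logb_pow, Nat.cast_sub (by omega), Nat.cast_sub (by omega)]
      exact_mod_cast h2
    rw [Real.logb_lt_iff_lt_rpow hp1 (by positivity), Real.rpow_natCast] at h6
    exact h6

end Ramification

end IwahoriSeries

theorem mainTheorem1 (p : ℕ) [Fact p.Prime] (n : ℕ) (hp : n + 1 < p)
    (K : Type*) [NormedField K] [NormedAlgebra ℚ_[p] K] [FiniteDimensional ℚ_[p] K]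
    (χ : Fin n → (ℤ_[p]ˣ →* Kˣ)) (c : Fin n → K)
    (hχ : ∀ i, IsLocallyAnalyticChar (χ i) (c i))
    (hc : ∀ i, LtValuation p ((ramificationIndex p K : ℝ) / ((p : ℝ) - 1) - 1) (c i))
    (hroot : (∃ ζ : K, IsPrimitiveRoot ζ p) → ∀ i, IsAnalyticOnOneUnits (χ i)) :
    ∃ Φ : ind χ ≃ₗ[K] AnalyticFunctionsU n K,
      (∀ f : ind χ, IsExpansionOnU (Φ f) f.1) ∧
      ∃ π : proPIwahori p n →* (AnalyticFunctionsU n K →L[K] AnalyticFunctionsU n K),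
        (∀ (h : proPIwahori p n) (f : ind χ),
          (Φ.symm (π h (Φ f))).1 = leftTranslate h f.1) ∧
        IsGloballyAnalyticRep π ∧ IsAdmissibleRep π := by
  have := isUltrametricDist_of_padic p K
  have : CompleteSpace K := FiniteDimensional.complete ℚ_[p] K
  refine exists_analytic_rep fun i => ?_
  by_cases h : ∃ ζ : K, IsPrimitiveRoot ζ p
  · exact hroot h i
  -- The existence of an index `i` forces `n ≥ 1`, so `p > n + 1` gives `p > 2`.
  · have hp2 : 2 < p := by
      have := i.pos
      omega
    exact isAnalyticOnOneUnits hp2 (hχ i) (norm_pow_lt_of_ltValuation hp2 (hc i)) h
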